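/- For $0\le\alpha\le1$ and $0\le\theta\le\pi/4$ let $|\psi_\theta\rangle=\cos\theta|00\rangle+\sin\theta|11\rangle$, $\rho_A^\theta=\mathrm{Tr}_B|\psi_\theta\rangle\langle\psi_\theta|$ and $$\rho_{\alpha,\theta}=\alpha|\psi_\theta\rangle\langle\psi_\theta|+(1-\alpha)\,\rho_A^\theta\otimes\tfrac{\mathbb 1}{2},$$ a two-qubit state of systems $A,B$. For $N\ge2$ take $N$ copies, on $A_1B_1,\dots,A_NB_N$, let $F_B=|0\cdots0\rangle\big(\langle0\cdots0|+\langle1\cdots1|\big)$ act on $B_1\cdots B_N$, and let $$\rho_{A_1\cdots A_N}=\frac{\mathrm{Tr}_B\big[(\mathbb 1_A\otimes F_B)\,\rho_{\alpha,\theta}^{\otimes N}\,(\mathbb 1_A\otimes F_B)^\dagger\big]}{\mathrm{Tr}\big[(\mathbb 1_A\otimes F_B)\,\rho_{\alpha,\theta}^{\otimes N}\,(\mathbb 1_A\otimes F_B)^\dagger\big]} .$$ An $N$-qubit state is genuinely multipartite entangled (GME) if it is not a convex mixture $\sum_b p_b\sum_j q^b_j\,|\phi^b_j\rangle\langle\phi^b_j|_b\otimes|\chi^b_j\rangle\langle\chi^b_j|_{\bar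 b}$ over bipartitions $(b,\bar b)$ of the parties into two nonempty groups. It admits a fully local hidden variable model for projective measurements if there are a probability measure $q$ on a space of hidden variables $\lambda$ and response functions $p^{(i)}_\lambda(a\mid M)$ (measurable in $\lambda$, and for each $\lambda$, $i$, $M$ a probability distribution in $a$) with $\mathrm{Tr}\big[\rho\,\bigotimes_i M^{(i)}_{a_i}\big]=\int\prod_i p^{(i)}_\lambda(a_i\mid M^{(i)})\,dq(\lambda)$ for all projective qubit measurements $M^{(1)},\dots,M^{(N)}$ and all outcomes $a_1,\dots,a_N$. For an $N$-qubit state $\rho$ put $n=2^{N-1}$ and $C(\rho)=2\max_{1\le i\le n}\big\{|z_i|-\sum_{j\ne i}\sqrt{c_jd_j}\big\}$, where $c_j$ and $d_j$ ($1\le j\le n$) are the $j$-th diagonal entries of $\rho$ counted from the top and from the bottom in the computational basis, and $z_i$ is the $i$-th anti-diagonal entry, $z_i=\rho_{i,\,2^N+1-i}$. Let $N\ge2$. (1) For all $0\le\alpha\le1$ and $0\le\theta\le\pi/4$, $\rho_{A_1\cdots A_N}$ is a well-defined state with $$C(\rho_{A_1\cdots A_N})=\frac{2\sin^N(2\theta)\Big(\alpha^N+\big[\tfrac{1+\alpha}2\big]^N+\big[\tfrac{1-\alpha}2\big]^N-1\Big)}{[1+\alpha\cos2\theta]^N+[1-\alpha\cos2\theta]^N};$$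 if this is positive, then $\rho_{A_1\cdots A_N}$ is GME; and if $\alpha>0$ and $\cos^2(2\theta)\ge\frac{2\alpha-1}{(2-\alpha)\alpha^3}$, then $\rho_{A_1\cdots A_N}$ admits a fully local hidden variable model for projective measurements. (2) Let $\alpha=1-1/N^2$. Then $\alpha^N+\big[\tfrac{1+\alpha}2\big]^N+\big[\tfrac{1-\alpha}2\big]^N>1$, there is $\theta\in(0,\pi/4]$ with $\cos^2(2\theta)=\frac{2\alpha-1}{(2-\alpha)\alpha^3}$, and for every such $\theta$ one has $C(\rho_{A_1\cdots A_N})>0$, the state $\rho_{A_1\cdots A_N}$ is GME, and it admits a fully local hidden variable model for all local projective measurements. In particular, for every $N\ge2$ there are GME $N$-qubit states with a fully local hidden variable model for projective measurements. -/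

import Mathlib

open scoped Kronecker ComplexOrder

noncomputable section

/-- Operators on `(ℂ²)^{⊗N}`, as matrices in the computational basis
`|x⟩ = |x₁,…,x_N⟩` indexed by the bit strings `x : Fin N → Fin 2`. -/
abbrev QubitOp (N : ℕ) := Matrix (Fin N → Fin 2) (Fin N → Fin 2) ℂ

/-- Density operators. -/
def IsDensity {d : Type*} [Fintype d] (ρ : Matrix d d ℂ) : Prop :=
  ρ.PosSemidef ∧ ρ.trace = 1

/-- `|φ⟩⟨φ|`. -/
def ketbra {d : Type*} (φ : d → ℂ) : Matrix d d ℂ := Matrix.vecMulVec φ (star φ)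

/-- Unit vectors. -/
def IsUnitVec {d : Type*} [Fintype d] (φ : d → ℂ) : Prop := ∑ x, ‖φ x‖ ^ 2 = 1

/-- Partial trace over the second tensor factor. -/
def traceB {a b : Type*} [Fintype b] (M : Matrix (a × b) (a × b) ℂ) : Matrix a a ℂ :=
  Matrix.of fun i j => ∑ k, M (i, k) (j, k)

/-! ### Genuine multipartite entanglement -/

/-- `A ⊗ B`, where `A` acts on the parties in `b` and `B` on the parties outside `b`. -/
def bipTensor {N : ℕ} (b : Finset (Fin N))
    (A : Matrix ({i // i ∈ b} → Fin 2) ({i // i ∈ b} → Fin 2) ℂ)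
    (B : Matrix ({i // i ∉ b} → Fin 2) ({i // i ∉ b} → Fin 2) ℂ) : QubitOp N :=
  Matrix.of fun x y =>
    A (fun i => x i) (fun i => y i) * B (fun i => x i) (fun i => y i)

/-- The bipartitions `(b, b̄)` of the `N` parties into two nonempty groups (each one is listed
twice, as `b` and as its complement, which does not affect convex mixtures). -/
def bipartitions (N : ℕ) : Finset (Finset (Fin N)) :=
  Finset.univ.filter fun b => b.Nonempty ∧ b ≠ Finset.univ

/-- Biseparable states: mixtures over the bipartitions `b` of mixtures of pure states that are
products across `b`. -/
def IsBiseparable {N : ℕ} (ρ : QubitOp N) : Prop :=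
  ∃ (p : Finset (Fin N) → ℝ) (m : Finset (Fin N) → ℕ)
    (q : (b : Finset (Fin N)) → Fin (m b) → ℝ)
    (φ : (b : Finset (Fin N)) → Fin (m b) → ({i // i ∈ b} → Fin 2) → ℂ)
    (χ : (b : Finset (Fin N)) → Fin (m b) → ({i // i ∉ b} → Fin 2) → ℂ),
    (∀ b ∈ bipartitions N, 0 ≤ p b) ∧ ∑ b ∈ bipartitions N, p b = 1 ∧
    (∀ b ∈ bipartitions N, (∀ j, 0 ≤ q b j) ∧ ∑ j, q b j = 1 ∧
      ∀ j, IsUnitVec (φ b j) ∧ IsUnitVec (χ b j)) ∧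
    ρ = ∑ b ∈ bipartitions N,
      (p b : ℂ) • ∑ j, (q b j : ℂ) • bipTensor b (ketbra (φ b j)) (ketbra (χ b j))

/-- Genuinely multipartite entangled states. -/
def IsGME {N : ℕ} (ρ : QubitOp N) : Prop := IsDensity ρ ∧ ¬ IsBiseparable ρ

/-- The bit strings whose first bit is `0`: the first half of the computational basis. The `j`-th
basis vector from the end is the bitwise complement `1 - x` of the `j`-th one `x`. -/
def firstHalf (N : ℕ) : Finset (Fin N → Fin 2) :=
  Finset.univ.filter fun x => ∀ i : Fin N, (i : ℕ) = 0 → x i = 0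

/-- `C(ρ) = 2 max_i (|z_i| - ∑_{j ≠ i} √(c_j d_j))`, where `c_j` and `d_j` are the `j`-th diagonal
entry of `ρ` from the start and from the end, and `z_i` is the `i`-th anti-diagonal entry. -/
def concurrence {N : ℕ} (ρ : QubitOp N) : ℝ :=
  2 * ⨆ x : {x // x ∈ firstHalf N},
    (‖ρ x.1 (1 - x.1)‖ -
      ∑ y ∈ (firstHalf N).erase x.1, √((ρ y y).re * (ρ (1 - y) (1 - y)).re))

/-! ### Local projective measurements and fully local models -/

/-- A projective measurement on a qubit with outcomes `0, …, k-1`: mutually orthogonal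
projections (possibly of rank 0 or 2) that sum to the identity. -/
structure ProjMeas (k : ℕ) where
  P : Fin k → Matrix (Fin 2) (Fin 2) ℂ
  herm : ∀ a, (P a).IsHermitian
  idem : ∀ a, P a * P a = P a
  orth : ∀ a b, a ≠ b → P a * P b = 0
  sum_eq_one : ∑ a, P a = 1

/-- `M₁ ⊗ ⋯ ⊗ M_N`. -/
def localTensor {N : ℕ} (M : Fin N → Matrix (Fin 2) (Fin 2) ℂ) : QubitOp N :=
  Matrix.of fun x y => ∏ i, M i (x i) (y i)

/-- `ρ` admits a fully local hidden variable model for all local projective measurements: one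
probability space of hidden variables `l`, and for each party `i` one response function
`r i k M a l = p_l(a | M)` depending only on the party's own measurement `M`, reproduce the
quantum statistics of all choices of local projective measurements. -/
def HasFullyLocalModel {N : ℕ} (ρ : QubitOp N) : Prop :=
  ∃ (Λ : Type) (_ : MeasurableSpace Λ) (μ : MeasureTheory.Measure Λ)
    (_ : MeasureTheory.IsProbabilityMeasure μ)
    (r : Fin N → (k : ℕ) → ProjMeas k → Fin k → Λ → ℝ),
    (∀ i k M a, Measurable (r i k M a)) ∧
    (∀ i k M a l, 0 ≤ r i k M a l) ∧
    (∀ i k M l, ∑ a, r i k M a l = 1) ∧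
    ∀ (k : Fin N → ℕ) (M : (i : Fin N) → ProjMeas (k i)) (a : (i : Fin N) → Fin (k i)),
      (ρ * localTensor fun i => (M i).P (a i)).trace =
        ((∫ l, ∏ i, r i (k i) (M i) (a i) l ∂μ : ℝ) : ℂ)

/-! ### The states -/

/-- `|ψ_θ⟩ = cos θ |00⟩ + sin θ |11⟩`. -/
def psi (θ : ℝ) : Fin 2 × Fin 2 → ℂ :=
  Pi.single (0, 0) (Real.cos θ : ℂ) + Pi.single (1, 1) (Real.sin θ : ℂ)

/-- `ρ_{α,θ} = α |ψ_θ⟩⟨ψ_θ| + (1 - α) ρ_A^θ ⊗ 𝟙/2`, with `ρ_A^θ = Tr_B |ψ_θ⟩⟨ψ_θ|`. -/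
def rhoTwo (α θ : ℝ) : Matrix (Fin 2 × Fin 2) (Fin 2 × Fin 2) ℂ :=
  (α : ℂ) • ketbra (psi θ) +
    ((1 - α : ℝ) : ℂ) •
      (traceB (ketbra (psi θ)) ⊗ₖ ((1 / 2 : ℂ) • (1 : Matrix (Fin 2) (Fin 2) ℂ)))

/-- `ρ^{⊗N}` on `(A₁ ⊗ ⋯ ⊗ A_N) ⊗ (B₁ ⊗ ⋯ ⊗ B_N)`. -/
def copies (N : ℕ) (ρ : Matrix (Fin 2 × Fin 2) (Fin 2 × Fin 2) ℂ) :
    Matrix ((Fin N → Fin 2) × (Fin N → Fin 2)) ((Fin N → Fin 2) × (Fin N → Fin 2)) ℂ :=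
  Matrix.of fun x y => ∏ i, ρ (x.1 i, x.2 i) (y.1 i, y.2 i)

/-- `F_B = |0⋯0⟩ (⟨0⋯0| + ⟨1⋯1|)`. -/
def ghzFilter (N : ℕ) : QubitOp N :=
  Matrix.vecMulVec (Pi.single 0 1) (Pi.single 0 1 + Pi.single 1 1)

/-- The unnormalized state `(𝟙_A ⊗ F_B) ρ_{α,θ}^{⊗N} (𝟙_A ⊗ F_B)†`. -/
def filtered (N : ℕ) (α θ : ℝ) :
    Matrix ((Fin N → Fin 2) × (Fin N → Fin 2)) ((Fin N → Fin 2) × (Fin N → Fin 2)) ℂ :=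
  ((1 : QubitOp N) ⊗ₖ ghzFilter N) * copies N (rhoTwo α θ) *
    ((1 : QubitOp N) ⊗ₖ ghzFilter N).conjTranspose

/-- The `N`-qubit state `ρ_{A₁⋯A_N}`. -/
def rhoA (N : ℕ) (α θ : ℝ) : QubitOp N :=
  (filtered N α θ).trace⁻¹ • traceB (filtered N α θ)

/-- The right-hand side `(2α - 1) / ((2 - α) α³)` of the unsteerability condition. -/
def steerBound (α : ℝ) : ℝ := (2 * α - 1) / ((2 - α) * α ^ 3)

end

/-! ### Explicit form of the state -/

/-! The filter has rank one, so only the block of `copies` in which all B-bits agree survives. The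
filtered state is therefore diagonal plus a single GHZ coherence `(α cos θ sin θ)^N` between `0` and
`1` (`traceB_filtered_eq`).

Entanglement. For a vector that is a product across `b`, flipping the bits in `b` preserves the
modulus of the product of an amplitude and its complementary amplitude. With Cauchy-Schwarz this
bounds each anti-diagonal entry of a biseparable state by the sum of `√(c_j d_j)` over the other
indices, so `C > 0` forces GME. For the state at hand `√(c_j d_j)` is `(cos θ sin θ)^N` times a
weight independent of `θ`. These weights sum to 1 over the first half of the basis and are largest
at `0`, which gives the closed formula (`concurrence_rhoA`).

Locality. One copy is unsteerable from A to B. Let `diag(b₀, b₁)` be the state of B. The hidden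
states of B are `√ρ_B (1 + n·σ) √ρ_B`, up to a choice of convention for the off-diagonal phase, with
`n` uniform on the sphere. A answers with a threshold function of `n` mixed with noise. Such an
answer has prescribed mean and first moment in `n`, by Archimedes' theorem, and the moments match
the assemblage exactly (`assemblage_eq_integral`). The mixture is a legitimate probability under an
inequality that follows from `steerBound α ≤ cos² 2θ` (`exists_unsteerableParams`). Now take `N`
copies: given the hidden directions, B holds a product state, and the filter passes it with a
nonnegative weight that does not depend on the measurements. Reweighting the product distribution by
this factor, divided by the success probability, gives the fully local model
(`hasFullyLocalModel_rhoA`).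

At `α = 1 - 1/N²`, Bernoulli's inequality keeps the concurrence positive, while the steering bound
stays in `[0, 1)` and is thus attained by some angle. -/

theorem trace_traceB {a b : Type*} [Fintype a] [Fintype b] (M : Matrix (a × b) (a × b) ℂ) :
    (traceB M).trace = M.trace := by
  simp [Matrix.trace, traceB, Fintype.sum_prod_type]

theorem rhoTwo_apply (α θ : ℝ) (x u y v : Fin 2) :
    rhoTwo α θ (x, u) (y, v) =
      α * (psi θ (x, u) * psi θ (y, v)) +
        if x = y ∧ u = v then
          (1 - α) / 2 * ((if x = 0 then Real.cos θ ^ 2 else Real.sin θ ^ 2 : ℝ) : ℂ) else 0 := by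
  fin_cases x <;> fin_cases u <;> fin_cases y <;> fin_cases v <;>
    simp [rhoTwo, ketbra, psi, traceB, Matrix.vecMulVec_apply, Pi.single_apply,
      -Complex.ofReal_cos, -Complex.ofReal_sin] <;> ring

/-- The filter maps everything onto `|0⋯0⟩`, so the trace over B leaves only the overlap with `⟨0⋯0|
+ ⟨1⋯1|`. This selects the constant B-strings `u` and `v`. -/
theorem traceB_filtered_apply (N : ℕ) (α θ : ℝ) (x y : Fin N → Fin 2) :
    traceB (filtered N α θ) x y =
      ∑ u : Fin 2, ∑ v : Fin 2, ∏ i, rhoTwo α θ (x i, u) (y i, v) := by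
  have h : ∀ u : Fin N → Fin 2, (star (Pi.single 0 1 + Pi.single 1 1 : (Fin N → Fin 2) → ℂ)) u
      = (Pi.single 0 1 + Pi.single 1 1 : (Fin N → Fin 2) → ℂ) u := by
    intro u
    simp [Pi.single_apply, apply_ite star]
  simp only [traceB, filtered, Matrix.of_apply, Matrix.mul_apply, Fintype.sum_prod_type,
    Matrix.kroneckerMap_apply, Matrix.conjTranspose_apply, Matrix.one_apply, ghzFilter,
    Matrix.vecMulVec_apply, copies, star_mul', apply_ite star, star_one, star_zero]
  simp [Pi.single_apply, apply_ite star, ite_mul, mul_ite, add_mul, mul_add,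
    Finset.sum_add_distrib, Fin.sum_univ_two]

/-- The unnormalised diagonal weight of the bit string `x`. -/
noncomputable def weight {N : ℕ} (α θ : ℝ) (x : Fin N → Fin 2) : ℝ :=
  (∏ i, if x i = 0 then (1 + α) / 2 * Real.cos θ ^ 2 else (1 - α) / 2 * Real.sin θ ^ 2) +
    ∏ i, if x i = 0 then (1 - α) / 2 * Real.cos θ ^ 2 else (1 + α) / 2 * Real.sin θ ^ 2

theorem traceB_filtered_eq {N : ℕ} (α θ : ℝ) (x y : Fin N → Fin 2) :
    traceB (filtered N α θ) x y =
      (((if x = y then weight α θ x else 0) +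
        (if x = 0 ∧ y = 1 then (α * (Real.cos θ * Real.sin θ)) ^ N else 0) +
        (if x = 1 ∧ y = 0 then (α * (Real.cos θ * Real.sin θ)) ^ N else 0) : ℝ) : ℂ) := by
  -- A product of bitwise factors survives only when every site satisfies its condition; a single
  -- failing site kills it.
  have key : ∀ (f : Fin 2 → Fin 2 → ℝ) (Q : Prop) [Decidable Q] (c : (Fin N) → ℝ),
      (Q → ∀ i, f (x i) (y i) = c i) → (¬ Q → ∃ i, f (x i) (y i) = 0) →
      ∏ i, f (x i) (y i) = if Q then ∏ i, c i else 0 := by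
    intro f Q _ c h1 h2
    split_ifs with hQ
    · exact Finset.prod_congr rfl fun i _ => h1 hQ i
    · obtain ⟨i, hi⟩ := h2 hQ
      exact Finset.prod_eq_zero (Finset.mem_univ i) hi
  have hne : ∀ a b : Fin N → Fin 2, ¬ (a = b) → ∃ i, a i ≠ b i := fun a b h =>
    Function.ne_iff.mp h
  rw [traceB_filtered_apply]
  simp only [Fin.sum_univ_two, rhoTwo_apply]
  have e00 : ∏ i, (if x i = y i then
      (if x i = 0 then (1 + α) / 2 * Real.cos θ ^ 2 else (1 - α) / 2 * Real.sin θ ^ 2) else 0) =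
      if x = y then ∏ i, (if x i = 0 then (1 + α) / 2 * Real.cos θ ^ 2
        else (1 - α) / 2 * Real.sin θ ^ 2) else 0 := by
    refine key (fun a b => if a = b then (if a = 0 then (1 + α) / 2 * Real.cos θ ^ 2
        else (1 - α) / 2 * Real.sin θ ^ 2) else 0) (x = y) _ ?_ ?_
    · rintro rfl i; simp
    · intro h; obtain ⟨i, hi⟩ := hne _ _ h; exact ⟨i, by simp [hi]⟩
  have e11 : ∏ i, (if x i = y i then
      (if x i = 0 then (1 - α) / 2 * Real.cos θ ^ 2 else (1 + α) / 2 * Real.sin θ ^ 2) else 0) =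
      if x = y then ∏ i, (if x i = 0 then (1 - α) / 2 * Real.cos θ ^ 2
        else (1 + α) / 2 * Real.sin θ ^ 2) else 0 := by
    refine key (fun a b => if a = b then (if a = 0 then (1 - α) / 2 * Real.cos θ ^ 2
        else (1 + α) / 2 * Real.sin θ ^ 2) else 0) (x = y) _ ?_ ?_
    · rintro rfl i; simp
    · intro h; obtain ⟨i, hi⟩ := hne _ _ h; exact ⟨i, by simp [hi]⟩
  have e01 : ∏ i, (if x i = 0 ∧ y i = 1 then α * (Real.cos θ * Real.sin θ) else 0) =
      if x = 0 ∧ y = 1 then ∏ _i : Fin N, (α * (Real.cos θ * Real.sin θ)) else 0 := by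
    refine key (fun a b => if a = 0 ∧ b = 1 then α * (Real.cos θ * Real.sin θ) else 0) _ _ ?_ ?_
    · rintro ⟨rfl, rfl⟩ i; simp
    · intro h
      rw [not_and_or] at h
      rcases h with h | h <;> obtain ⟨i, hi⟩ := hne _ _ h <;>
        exact ⟨i, if_neg (by simp at hi; simp [hi])⟩
  have e10 : ∏ i, (if x i = 1 ∧ y i = 0 then α * (Real.cos θ * Real.sin θ) else 0) =
      if x = 1 ∧ y = 0 then ∏ _i : Fin N, (α * (Real.cos θ * Real.sin θ)) else 0 := by
    refine key (fun a b => if a = 1 ∧ b = 0 then α * (Real.cos θ * Real.sin θ) else 0) _ _ ?_ ?_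
    · rintro ⟨rfl, rfl⟩ i; simp
    · intro h
      rw [not_and_or] at h
      rcases h with h | h <;> obtain ⟨i, hi⟩ := hne _ _ h <;>
        exact ⟨i, if_neg (by simp at hi; simp [hi])⟩
  rw [Finset.prod_const, Finset.card_univ, Fintype.card_fin] at e01 e10
  have hw : (if x = y then weight α θ x else 0) =
      (∏ i, (if x i = y i then
      (if x i = 0 then (1 + α) / 2 * Real.cos θ ^ 2 else (1 - α) / 2 * Real.sin θ ^ 2) else 0)) +
      ∏ i, (if x i = y i then
      (if x i = 0 then (1 - α) / 2 * Real.cos θ ^ 2 else (1 + α) / 2 * Real.sin θ ^ 2) else 0) := by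
    rw [e00, e11, weight]; split_ifs <;> simp
  rw [← e01, ← e10, hw]
  push_cast
  have aux : ∀ a b c d a' b' c' d' : ℂ, a = a' → b = b' → c = c' → d = d' →
      a + b + (c + d) = a' + d' + b' + c' := by
    rintro a b c d _ _ _ _ rfl rfl rfl rfl; ring
  apply aux <;> refine Finset.prod_congr rfl fun i _ => ?_ <;>
    generalize x i = s <;> generalize y i = t <;> fin_cases s <;> fin_cases t <;>
    simp [psi] <;> first | ring1 | (left; ring1)

/-! ### Biseparable states have nonpositive concurrence -/

theorem bipTensor_ketbra {N : ℕ} (b : Finset (Fin N)) (φ : ({i // i ∈ b} → Fin 2) → ℂ)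
    (χ : ({i // i ∉ b} → Fin 2) → ℂ) :
    bipTensor b (ketbra φ) (ketbra χ) = ketbra fun x => φ (fun i => x i) * χ (fun i => x i) := by
  ext x y
  simp only [bipTensor, ketbra, Matrix.of_apply, Matrix.vecMulVec_apply, Pi.star_apply, star_mul']
  ring

theorem one_sub_one_sub_bits {N : ℕ} (x : Fin N → Fin 2) : 1 - (1 - x) = x := by
  simp

theorem one_sub_mem_firstHalf {N : ℕ} (hN : 1 ≤ N) (x : Fin N → Fin 2) :
    1 - x ∈ firstHalf N ↔ x ∉ firstHalf N := by
  have h : ∀ y : Fin N → Fin 2, y ∈ firstHalf N ↔ y ⟨0, hN⟩ = 0 := by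
    intro y
    simp only [firstHalf, Finset.mem_filter, Finset.mem_univ, true_and]
    refine ⟨fun h => h _ rfl, fun h i hi => ?_⟩
    rwa [show i = ⟨0, hN⟩ from Fin.ext hi]
  rw [h, h, Pi.sub_apply, Pi.one_apply]
  generalize x ⟨0, hN⟩ = t
  fin_cases t <;> simp

/-- Each pure component trades its anti-diagonal product at `x` for the one at some `y ∈ S`,
depending on the component. Summing over all of `S` removes this dependence, and Cauchy-Schwarz over
the mixture turns each summand into a product of diagonal entries. -/
theorem norm_antidiag_le_of_mixture {N : ℕ} {ι : Type*} (s : Finset ι) (w : ι → ℝ)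
    (hw : ∀ i ∈ s, 0 ≤ w i) (ψ : ι → (Fin N → Fin 2) → ℂ) (x : Fin N → Fin 2)
    (S : Finset (Fin N → Fin 2))
    (hψ : ∀ i ∈ s, ∃ y ∈ S, ‖ψ i x‖ * ‖ψ i (1 - x)‖ = ‖ψ i y‖ * ‖ψ i (1 - y)‖)
    (ρ : QubitOp N) (hρ : ρ = ∑ i ∈ s, (w i : ℂ) • ketbra (ψ i)) :
    ‖ρ x (1 - x)‖ ≤ ∑ y ∈ S, √((ρ y y).re * (ρ (1 - y) (1 - y)).re) := by
  have hdiag : ∀ y, (ρ y y).re = ∑ i ∈ s, w i * ‖ψ i y‖ ^ 2 := by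
    intro y
    rw [hρ, Matrix.sum_apply, Complex.re_sum]
    refine Finset.sum_congr rfl fun i _ => ?_
    simp only [Matrix.smul_apply, ketbra, Matrix.vecMulVec_apply, Pi.star_apply, smul_eq_mul,
      Complex.star_def, Complex.mul_conj, Complex.re_ofReal_mul, Complex.ofReal_re,
      Complex.normSq_eq_norm_sq]
  calc ‖ρ x (1 - x)‖ ≤ ∑ i ∈ s, w i * (‖ψ i x‖ * ‖ψ i (1 - x)‖) := by
        rw [hρ, Matrix.sum_apply]
        refine (norm_sum_le _ _).trans (Finset.sum_le_sum fun i hi => ?_)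
        simp [ketbra, Matrix.vecMulVec_apply, abs_of_nonneg (hw i hi)]
    _ ≤ ∑ i ∈ s, ∑ y ∈ S, w i * (‖ψ i y‖ * ‖ψ i (1 - y)‖) := by
        refine Finset.sum_le_sum fun i hi => ?_
        obtain ⟨y, hy, h⟩ := hψ i hi
        rw [h]
        exact Finset.single_le_sum (f := fun y => w i * (‖ψ i y‖ * ‖ψ i (1 - y)‖))
          (fun z _ => mul_nonneg (hw i hi) (by positivity)) hy
    _ = ∑ y ∈ S, ∑ i ∈ s, w i * (‖ψ i y‖ * ‖ψ i (1 - y)‖) := Finset.sum_comm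
    _ ≤ _ := by
        refine Finset.sum_le_sum fun y _ => ?_
        rw [hdiag, hdiag]
        have h0 : ∀ z, ∀ i ∈ s, 0 ≤ w i * ‖ψ i z‖ ^ 2 := fun z i hi =>
          mul_nonneg (hw i hi) (by positivity)
        rw [Real.sqrt_mul (Finset.sum_nonneg (h0 y))]
        calc ∑ i ∈ s, w i * (‖ψ i y‖ * ‖ψ i (1 - y)‖)
            = ∑ i ∈ s, √(w i * ‖ψ i y‖ ^ 2) * √(w i * ‖ψ i (1 - y)‖ ^ 2) := by
              refine Finset.sum_congr rfl fun i hi => ?_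
              rw [Real.sqrt_mul (hw i hi), Real.sqrt_mul (hw i hi),
                Real.sqrt_sq (norm_nonneg _), Real.sqrt_sq (norm_nonneg _)]
              linear_combination (-‖ψ i y‖ * ‖ψ i (1 - y)‖) * Real.mul_self_sqrt (hw i hi)
          _ ≤ √(∑ i ∈ s, w i * ‖ψ i y‖ ^ 2) * √(∑ i ∈ s, w i * ‖ψ i (1 - y)‖ ^ 2) := by
              have := Real.sum_mul_le_sqrt_mul_sqrt s (fun i => √(w i * ‖ψ i y‖ ^ 2))
                (fun i => √(w i * ‖ψ i (1 - y)‖ ^ 2))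
              rwa [Finset.sum_congr rfl fun i hi => Real.sq_sqrt (h0 y i hi),
                Finset.sum_congr rfl fun i hi => Real.sq_sqrt (h0 (1 - y) i hi)] at this

theorem concurrence_nonpos_of_isBiseparable {N : ℕ} (hN : 1 ≤ N) {ρ : QubitOp N}
    (h : IsBiseparable ρ) : concurrence ρ ≤ 0 := by
  obtain ⟨p, m, q, φ, χ, hp, -, hq, hρ⟩ := h
  have : Nonempty {x // x ∈ firstHalf N} := ⟨⟨0, by simp [firstHalf]⟩⟩
  refine mul_nonpos_of_nonneg_of_nonpos zero_le_two (ciSup_le fun ⟨x, hx⟩ => ?_)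
  rw [sub_nonpos]
  refine norm_antidiag_le_of_mixture
    ((bipartitions N).sigma fun b => (Finset.univ : Finset (Fin (m b))))
    (fun i => p i.1 * q i.1 i.2)
    (fun i hi => ?_)
    (fun i x => φ i.1 i.2 (fun k => x k) * χ i.1 i.2 (fun k => x k)) x _ ?_ ρ ?_
  · rw [Finset.mem_sigma] at hi
    exact mul_nonneg (hp _ hi.1) ((hq _ hi.1).1 _)
  · rintro ⟨b, j⟩ hb
    rw [Finset.mem_sigma] at hb
    simp only [bipartitions, Finset.mem_filter, Finset.mem_univ, true_and] at hb
    obtain ⟨⟨⟨k, hk⟩, hb2⟩, -⟩ := hb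
    obtain ⟨l, hl⟩ : ∃ l, l ∉ b := by
      by_contra! hcon
      exact hb2 (Finset.eq_univ_iff_forall.mpr hcon)
    classical
    have hflip : ∀ t : Fin 2, 1 - t ≠ t := by decide
    -- The string `y` flips `x` on `b` only. Both groups are nonempty, so neither `y` nor its
    -- complement equals `x`, and one of the two lies in the first half.
    set y : Fin N → Fin 2 := fun i => if i ∈ b then 1 - x i else x i with hy
    have hyx : y ≠ x := fun h => hflip (x k) (by simpa [hy, hk] using congrFun h k)
    have hyx' : 1 - y ≠ x := fun h => hflip (x l) (by simpa [hy, hl] using congrFun h l)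
    have e1 : (fun i : {i // i ∈ b} => y i) = fun i : {i // i ∈ b} => (1 - x) i :=
      funext fun i => by simp [hy, i.2]
    have e2 : (fun i : {i // i ∉ b} => y i) = fun i : {i // i ∉ b} => x i :=
      funext fun i => by simp [hy, i.2]
    have e3 : (fun i : {i // i ∈ b} => (1 - y) i) = fun i : {i // i ∈ b} => x i :=
      funext fun i => by simp [hy, i.2]
    have e4 : (fun i : {i // i ∉ b} => (1 - y) i) = fun i : {i // i ∉ b} => (1 - x) i :=
      funext fun i => by simp [hy, i.2]
    by_cases hmem : y ∈ firstHalf N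
    · refine ⟨y, Finset.mem_erase.mpr ⟨hyx, hmem⟩, ?_⟩
      simp only [e1, e2, e3, e4, norm_mul]
      ring
    · refine ⟨1 - y, Finset.mem_erase.mpr ⟨hyx', (one_sub_mem_firstHalf hN y).mpr hmem⟩, ?_⟩
      simp only [one_sub_one_sub_bits, e1, e2, e3, e4, norm_mul]
      ring
  · rw [hρ, Finset.sum_sigma]
    refine Finset.sum_congr rfl fun b _ => ?_
    rw [Finset.smul_sum]
    refine Finset.sum_congr rfl fun j _ => ?_
    rw [bipTensor_ketbra, smul_smul, Complex.ofReal_mul]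

theorem isGME_of_concurrence_pos {N : ℕ} (hN : 1 ≤ N) {ρ : QubitOp N} (hρ : IsDensity ρ)
    (h : 0 < concurrence ρ) : IsGME ρ :=
  ⟨hρ, fun hb => (concurrence_nonpos_of_isBiseparable hN hb).not_gt h⟩

/-! ### Normalisation, positivity and concurrence of the state -/

theorem bits_zero_ne_one {N : ℕ} (hN : 1 ≤ N) : (0 : Fin N → Fin 2) ≠ 1 := fun h =>
  absurd (congrFun h ⟨0, hN⟩) (by simp)

theorem sum_prod_bits {N : ℕ} (a b : ℝ) :
    ∑ x : Fin N → Fin 2, ∏ i, (if x i = 0 then a else b) = (a + b) ^ N := by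
  have := Fintype.sum_pow (fun t : Fin 2 => if t = 0 then a else b) N
  simpa using this.symm

/-- The probability of success of the filter. -/
noncomputable def successProb (N : ℕ) (α θ : ℝ) : ℝ :=
  ((1 + α * Real.cos (2 * θ)) / 2) ^ N + ((1 - α * Real.cos (2 * θ)) / 2) ^ N

theorem sum_weight (N : ℕ) (α θ : ℝ) :
    ∑ x : Fin N → Fin 2, weight α θ x = successProb N α θ := by
  simp only [weight, Finset.sum_add_distrib, sum_prod_bits, successProb, Real.cos_two_mul,
    Real.sin_sq]
  congr 2 <;> ring

theorem trace_filtered {N : ℕ} (hN : 1 ≤ N) (α θ : ℝ) :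
    (filtered N α θ).trace = (successProb N α θ : ℂ) := by
  have h := bits_zero_ne_one hN
  rw [← trace_traceB, Matrix.trace, ← sum_weight, Complex.ofReal_sum]
  refine Finset.sum_congr rfl fun x _ => ?_
  rw [Matrix.diag_apply, traceB_filtered_eq]
  have h1 : ¬ (x = 0 ∧ x = 1) := fun h' => h (h'.1.symm.trans h'.2)
  have h2 : ¬ (x = 1 ∧ x = 0) := fun h' => h (h'.2.symm.trans h'.1)
  simp [h1, h2]

theorem cos_two_mul_nonneg {θ : ℝ} (h0 : 0 ≤ θ) (h1 : θ ≤ Real.pi / 4) :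
    0 ≤ Real.cos (2 * θ) :=
  Real.cos_nonneg_of_mem_Icc ⟨by linarith [Real.pi_pos], by linarith⟩

theorem sin_nonneg_of_le_pi_div_four {θ : ℝ} (h0 : 0 ≤ θ) (h1 : θ ≤ Real.pi / 4) :
    0 ≤ Real.sin θ :=
  Real.sin_nonneg_of_nonneg_of_le_pi h0 (by linarith [Real.pi_pos])

theorem cos_nonneg_of_le_pi_div_four {θ : ℝ} (h0 : 0 ≤ θ) (h1 : θ ≤ Real.pi / 4) :
    0 ≤ Real.cos θ :=
  Real.cos_nonneg_of_mem_Icc ⟨by linarith [Real.pi_pos], by linarith [Real.pi_pos]⟩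

theorem successProb_pos (N : ℕ) {α θ : ℝ} (hα0 : 0 ≤ α) (hα1 : α ≤ 1) (h0 : 0 ≤ θ)
    (h1 : θ ≤ Real.pi / 4) : 0 < successProb N α θ := by
  have hc := cos_two_mul_nonneg h0 h1
  have hc1 := Real.cos_le_one (2 * θ)
  have h : 0 ≤ (1 - α * Real.cos (2 * θ)) / 2 := by nlinarith
  unfold successProb
  positivity

theorem rhoA_apply {N : ℕ} (hN : 1 ≤ N) (α θ : ℝ) (x y : Fin N → Fin 2) :
    rhoA N α θ x y =
      (((successProb N α θ)⁻¹ * ((if x = y then weight α θ x else 0) +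
        (if x = 0 ∧ y = 1 then (α * (Real.cos θ * Real.sin θ)) ^ N else 0) +
        (if x = 1 ∧ y = 0 then (α * (Real.cos θ * Real.sin θ)) ^ N else 0)) : ℝ) : ℂ) := by
  rw [rhoA, Matrix.smul_apply, traceB_filtered_eq, trace_filtered hN, smul_eq_mul,
    Complex.ofReal_mul, Complex.ofReal_inv]

/-- The part of the diagonal weight that does not depend on `θ`. -/
noncomputable def noiseWeight {N : ℕ} (α : ℝ) (x : Fin N → Fin 2) : ℝ :=
  (∏ i, if x i = 0 then (1 + α) / 2 else (1 - α) / 2) +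
    ∏ i, if x i = 0 then (1 - α) / 2 else (1 + α) / 2

theorem weight_eq {N : ℕ} (α θ : ℝ) (x : Fin N → Fin 2) :
    weight α θ x =
      (∏ i, if x i = 0 then Real.cos θ ^ 2 else Real.sin θ ^ 2) * noiseWeight α x := by
  rw [weight, noiseWeight, mul_add, ← Finset.prod_mul_distrib, ← Finset.prod_mul_distrib]
  congr 1 <;> refine Finset.prod_congr rfl fun i _ => ?_ <;> split_ifs <;> ring

theorem noiseWeight_nonneg {N : ℕ} {α : ℝ} (hα0 : 0 ≤ α) (hα1 : α ≤ 1) (x : Fin N → Fin 2) :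
    0 ≤ noiseWeight α x := by
  have h : 0 ≤ (1 - α) / 2 := by linarith
  have h' : 0 ≤ (1 + α) / 2 := by linarith
  refine add_nonneg (Finset.prod_nonneg fun i _ => ?_) (Finset.prod_nonneg fun i _ => ?_) <;>
    split_ifs <;> assumption

theorem weight_nonneg {N : ℕ} {α : ℝ} (hα0 : 0 ≤ α) (hα1 : α ≤ 1) (θ : ℝ)
    (x : Fin N → Fin 2) : 0 ≤ weight α θ x := by
  rw [weight_eq]
  refine mul_nonneg (Finset.prod_nonneg fun i _ => ?_) (noiseWeight_nonneg hα0 hα1 x)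
  split_ifs <;> positivity

theorem noiseWeight_one_sub {N : ℕ} (α : ℝ) (x : Fin N → Fin 2) :
    noiseWeight α (1 - x) = noiseWeight α x := by
  rw [noiseWeight, noiseWeight, add_comm]
  congr 1 <;> refine Finset.prod_congr rfl fun i _ => ?_ <;>
    rw [Pi.sub_apply, Pi.one_apply] <;> generalize x i = t <;> fin_cases t <;> simp

theorem noiseWeight_zero (N : ℕ) (α : ℝ) :
    noiseWeight α (0 : Fin N → Fin 2) = ((1 + α) / 2) ^ N + ((1 - α) / 2) ^ N := by
  simp [noiseWeight, div_pow]

/-- With `p = (1 + α)/2`, `q = (1 - α)/2` and a string of `k` zeros and `l` ones, the claim is `(p^k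
- q^k)(p^l - q^l) ≥ 0`. -/
theorem noiseWeight_le {N : ℕ} {α : ℝ} (hα0 : 0 ≤ α) (hα1 : α ≤ 1) (x : Fin N → Fin 2) :
    noiseWeight α x ≤ ((1 + α) / 2) ^ N + ((1 - α) / 2) ^ N := by
  have hq : 0 ≤ (1 - α) / 2 := by linarith
  have hqp : (1 - α) / 2 ≤ (1 + α) / 2 := by linarith
  have hcard : (Finset.univ.filter fun i => x i = 0).card +
      (Finset.univ.filter fun i => ¬ x i = 0).card = N := by
    rw [Finset.card_filter_add_card_filter_not, Finset.card_univ, Fintype.card_fin]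
  simp only [noiseWeight, Finset.prod_ite, Finset.prod_const]
  generalize (Finset.univ.filter fun i => x i = 0).card = k at *
  generalize (Finset.univ.filter fun i => ¬ x i = 0).card = l at *
  rw [← hcard, pow_add, pow_add]
  have h1 := pow_le_pow_left₀ hq hqp k
  have h2 := pow_le_pow_left₀ hq hqp l
  nlinarith [mul_nonneg (sub_nonneg.mpr h1) (sub_nonneg.mpr h2)]

/-- At each site exactly one of `x` and `1 - x` contributes `cos² θ` and the other `sin² θ`, so the
dependence on `θ` is the same for every string. -/
theorem sqrt_weight_mul {N : ℕ} {α θ : ℝ} (hα0 : 0 ≤ α) (hα1 : α ≤ 1) (h0 : 0 ≤ θ)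
    (h1 : θ ≤ Real.pi / 4) (x : Fin N → Fin 2) :
    √(weight α θ x * weight α θ (1 - x)) =
      (Real.cos θ * Real.sin θ) ^ N * noiseWeight α x := by
  have hs := sin_nonneg_of_le_pi_div_four h0 h1
  have hc := cos_nonneg_of_le_pi_div_four h0 h1
  have hn := noiseWeight_nonneg hα0 hα1 x
  have hprod : (∏ i, if x i = 0 then Real.cos θ ^ 2 else Real.sin θ ^ 2) *
      (∏ i, if (1 - x) i = 0 then Real.cos θ ^ 2 else Real.sin θ ^ 2) =
      ((Real.cos θ * Real.sin θ) ^ N) ^ 2 := by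
    rw [← Finset.prod_mul_distrib, ← pow_mul, mul_comm N, pow_mul]
    calc _ = ∏ _i : Fin N, (Real.cos θ * Real.sin θ) ^ 2 := by
          refine Finset.prod_congr rfl fun i _ => ?_
          rw [Pi.sub_apply, Pi.one_apply]
          generalize x i = t
          fin_cases t <;> simp <;> ring
      _ = _ := by simp
  rw [weight_eq, weight_eq, noiseWeight_one_sub, mul_mul_mul_comm, hprod, ← sq, ← mul_pow,
    Real.sqrt_sq (by positivity)]

theorem sum_firstHalf_noiseWeight {N : ℕ} (hN : 1 ≤ N) (α : ℝ) :
    ∑ x ∈ firstHalf N, noiseWeight α x = 1 := by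
  have hall : ∑ x : Fin N → Fin 2, noiseWeight α x = 2 := by
    simp only [noiseWeight, Finset.sum_add_distrib, sum_prod_bits]
    rw [show (1 + α) / 2 + (1 - α) / 2 = 1 by ring, show (1 - α) / 2 + (1 + α) / 2 = 1 by ring]
    norm_num
  have hcompl : ∑ x ∈ (firstHalf N)ᶜ, noiseWeight α x = ∑ x ∈ firstHalf N, noiseWeight α x := by
    refine Finset.sum_nbij' (fun x => 1 - x) (fun x => 1 - x) ?_ ?_ ?_ ?_ ?_
    · intro x hx
      exact (one_sub_mem_firstHalf hN x).mpr (Finset.mem_compl.mp hx)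
    · intro x hx
      rw [Finset.mem_compl, one_sub_mem_firstHalf hN, not_not]
      exact hx
    · intro x _; exact one_sub_one_sub_bits x
    · intro x _; exact one_sub_one_sub_bits x
    · intro x _; exact (noiseWeight_one_sub α x).symm
  have := Finset.sum_add_sum_compl (firstHalf N) (noiseWeight α)
  rw [hall, hcompl] at this
  linarith

theorem isDensity_rhoA {N : ℕ} (hN : 1 ≤ N) {α θ : ℝ} (hα0 : 0 ≤ α) (hα1 : α ≤ 1) (h0 : 0 ≤ θ)
    (h1 : θ ≤ Real.pi / 4) : IsDensity (rhoA N α θ) := by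
  have hZ := successProb_pos N hα0 hα1 h0 h1
  have h01 := bits_zero_ne_one hN
  constructor
  -- The state is split as a diagonal matrix plus `α^N |v⟩⟨v|` with `v = cos^N θ |0⟩ + sin^N θ |1⟩`.
  -- The remaining diagonal `d` is nonnegative because `α ≤ (1 + α)/2`.
  · set v : (Fin N → Fin 2) → ℂ :=
      Pi.single 0 ((Real.cos θ ^ N : ℝ) : ℂ) + Pi.single 1 ((Real.sin θ ^ N : ℝ) : ℂ) with hv
    set d : (Fin N → Fin 2) → ℝ := fun x => weight α θ x -
      α ^ N * ((if x = 0 then (Real.cos θ ^ N) ^ 2 else 0) +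
        (if x = 1 then (Real.sin θ ^ N) ^ 2 else 0)) with hd
    have hαp : α ^ N ≤ ((1 + α) / 2) ^ N + ((1 - α) / 2) ^ N := by
      have h2 : α ^ N ≤ ((1 + α) / 2) ^ N := pow_le_pow_left₀ hα0 (by linarith) N
      have h3 : 0 ≤ ((1 - α) / 2) ^ N := pow_nonneg (by linarith) N
      linarith
    have hd0 : ∀ x, 0 ≤ d x := by
      intro x
      simp only [hd]
      by_cases hx0 : x = 0
      · subst hx0
        rw [weight_eq, noiseWeight_zero]
        simp only [Pi.zero_apply, if_true, Finset.prod_const, Finset.card_univ, Fintype.card_fin,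
          if_neg h01, add_zero]
        rw [← pow_mul, mul_comm 2 N, pow_mul]
        nlinarith [sq_nonneg (Real.cos θ ^ N)]
      by_cases hx1 : x = 1
      · subst hx1
        have : noiseWeight α (1 : Fin N → Fin 2) = noiseWeight α (0 : Fin N → Fin 2) := by
          rw [← noiseWeight_one_sub, sub_self]
        rw [weight_eq, this, noiseWeight_zero]
        simp only [Pi.one_apply, if_true, Finset.prod_const, Finset.card_univ, Fintype.card_fin,
          if_neg h01.symm, zero_add, one_ne_zero, if_false]
        rw [← pow_mul, mul_comm 2 N, pow_mul]
        nlinarith [sq_nonneg (Real.sin θ ^ N)]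
      · simpa [hx0, hx1] using weight_nonneg hα0 hα1 θ x
    have hM : rhoA N α θ = (((successProb N α θ)⁻¹ : ℝ) : ℂ) •
        (Matrix.diagonal (fun x => (d x : ℂ)) + ((α ^ N : ℝ) : ℂ) •
          Matrix.vecMulVec v (star v)) := by
      ext x y
      rw [rhoA_apply hN, Matrix.smul_apply, smul_eq_mul, Complex.ofReal_mul]
      congr 1
      simp only [Matrix.add_apply, Matrix.diagonal_apply, Matrix.smul_apply,
        Matrix.vecMulVec_apply, hv, hd, Pi.star_apply, Pi.add_apply, Pi.single_apply, mul_pow]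
      generalize Real.cos θ ^ N = c
      generalize Real.sin θ ^ N = s
      by_cases hxy : x = y
      · subst hxy
        by_cases hx0 : x = 0
        · subst hx0; simp [h01]; ring
        · by_cases hx1 : x = 1
          · subst hx1; simp [h01.symm]; ring
          · simp [hx0, hx1]
      · by_cases hx0 : x = 0
        · subst hx0
          have hy0 : y ≠ 0 := fun h => hxy h.symm
          by_cases hy1 : y = 1 <;> simp [h01, h01.symm, hy0, hy1, hxy]
        · by_cases hx1 : x = 1
          · subst hx1
            have hy1 : y ≠ 1 := fun h => hxy h.symm
            by_cases hy0 : y = 0 <;> simp [h01, h01.symm, hy0, hy1, hxy]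
            left; ring
          · simp [hx0, hx1, hxy]
    rw [hM]
    refine Matrix.PosSemidef.smul (Matrix.PosSemidef.add ?_ (Matrix.PosSemidef.smul ?_ ?_)) ?_
    · exact Matrix.PosSemidef.diagonal fun x => by simpa using hd0 x
    · exact Matrix.posSemidef_vecMulVec_self_star v
    · exact_mod_cast pow_nonneg hα0 N
    · exact_mod_cast inv_nonneg.mpr hZ.le
  · rw [rhoA, Matrix.trace_smul, trace_traceB, smul_eq_mul, inv_mul_cancel₀]
    rw [trace_filtered hN]
    exact_mod_cast hZ.ne'

theorem concurrence_rhoA {N : ℕ} (hN : 1 ≤ N) {α θ : ℝ} (hα0 : 0 ≤ α) (hα1 : α ≤ 1)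
    (h0 : 0 ≤ θ) (h1 : θ ≤ Real.pi / 4) :
    concurrence (rhoA N α θ) =
        2 * Real.sin (2 * θ) ^ N *
            (α ^ N + ((1 + α) / 2) ^ N + ((1 - α) / 2) ^ N - 1) /
          ((1 + α * Real.cos (2 * θ)) ^ N + (1 - α * Real.cos (2 * θ)) ^ N) := by
  have hZ := successProb_pos N hα0 hα1 h0 h1
  have h01 := bits_zero_ne_one hN
  have hs := sin_nonneg_of_le_pi_div_four h0 h1
  have hc := cos_nonneg_of_le_pi_div_four h0 h1
  set Z := successProb N α θ with hZdef
  set g := (Real.cos θ * Real.sin θ) ^ N with hg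
  have hg0 : 0 ≤ g := by positivity
  have hdiag : ∀ y : Fin N → Fin 2, (rhoA N α θ y y).re = Z⁻¹ * weight α θ y := by
    intro y
    rw [rhoA_apply hN, Complex.ofReal_re]
    have e1 : ¬ (y = 0 ∧ y = 1) := fun h' => h01 (h'.1.symm.trans h'.2)
    have e2 : ¬ (y = 1 ∧ y = 0) := fun h' => h01 (h'.2.symm.trans h'.1)
    simp [e1, e2, hZdef]
  have hsum : ∀ x ∈ firstHalf N, ∑ y ∈ (firstHalf N).erase x,
      √((rhoA N α θ y y).re * (rhoA N α θ (1 - y) (1 - y)).re) =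
      Z⁻¹ * g * (1 - noiseWeight α x) := by
    intro x hx
    have : ∀ y : Fin N → Fin 2, √((rhoA N α θ y y).re * (rhoA N α θ (1 - y) (1 - y)).re) =
        Z⁻¹ * g * noiseWeight α y := by
      intro y
      rw [hdiag, hdiag, mul_mul_mul_comm, Real.sqrt_mul (by positivity),
        Real.sqrt_mul_self (inv_nonneg.mpr hZ.le), sqrt_weight_mul hα0 hα1 h0 h1, mul_assoc]
    simp only [this]
    rw [← Finset.mul_sum, ← sum_firstHalf_noiseWeight hN α, ← Finset.add_sum_erase _ _ hx]
    ring
  -- Within the first half only `x = 0` meets the GHZ coherence.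
  have hanti : ∀ x ∈ firstHalf N, ‖rhoA N α θ x (1 - x)‖ =
      if x = 0 then Z⁻¹ * g * α ^ N else 0 := by
    intro x hx
    have hne : x ≠ 1 - x := fun h => by
      have := congrFun h ⟨0, hN⟩
      rw [Pi.sub_apply, Pi.one_apply] at this
      revert this
      generalize x ⟨0, hN⟩ = t
      fin_cases t <;> simp
    rw [rhoA_apply hN, Complex.norm_real, Real.norm_eq_abs]
    by_cases hx0 : x = 0
    · subst hx0
      simp only [sub_zero, if_neg h01, if_true, and_self]
      rw [abs_of_nonneg (by positivity), mul_pow]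
      simp only [h01, false_and, if_false, hg]
      ring
    · have hx1 : x ≠ 1 := fun h => by
        subst h
        have := (one_sub_mem_firstHalf hN 1).mp (by simp [firstHalf])
        exact this hx
      simp [hx0, hx1, hne]
  have hterm : ∀ x : {x // x ∈ firstHalf N}, (‖rhoA N α θ x.1 (1 - x.1)‖ -
      ∑ y ∈ (firstHalf N).erase x.1,
        √((rhoA N α θ y y).re * (rhoA N α θ (1 - y) (1 - y)).re)) ≤
      Z⁻¹ * g * (α ^ N + ((1 + α) / 2) ^ N + ((1 - α) / 2) ^ N - 1) := by
    rintro ⟨x, hx⟩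
    rw [hsum x hx, hanti x hx]
    have hle := noiseWeight_le hα0 hα1 x
    have hk : 0 ≤ Z⁻¹ * g := by positivity
    have hαN : 0 ≤ α ^ N := by positivity
    split_ifs <;> nlinarith
  have hmem : (0 : Fin N → Fin 2) ∈ firstHalf N := by simp [firstHalf]
  have : Nonempty {x // x ∈ firstHalf N} := ⟨⟨0, hmem⟩⟩
  have hsup : (⨆ x : {x // x ∈ firstHalf N}, (‖rhoA N α θ x.1 (1 - x.1)‖ -
      ∑ y ∈ (firstHalf N).erase x.1,
        √((rhoA N α θ y y).re * (rhoA N α θ (1 - y) (1 - y)).re))) =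
      Z⁻¹ * g * (α ^ N + ((1 + α) / 2) ^ N + ((1 - α) / 2) ^ N - 1) := by
    refine le_antisymm (ciSup_le hterm) ?_
    refine le_trans (le_of_eq ?_) (le_ciSup (Set.finite_range _).bddAbove ⟨0, hmem⟩)
    rw [hsum 0 hmem, hanti 0 hmem, noiseWeight_zero, if_pos rfl]
    ring
  rw [concurrence, hsup, hZdef, successProb, hg, Real.sin_two_mul, div_pow, div_pow, ← add_div]
  have hpos : (1 + α * Real.cos (2 * θ)) ^ N + (1 - α * Real.cos (2 * θ)) ^ N ≠ 0 := by
    intro h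
    rw [hZdef, successProb, div_pow, div_pow, ← add_div, h, zero_div] at hZ
    exact lt_irrefl _ hZ
  rw [inv_div, show 2 * Real.sin θ * Real.cos θ = 2 * (Real.cos θ * Real.sin θ) by ring,
    mul_pow 2 (Real.cos θ * Real.sin θ)]
  generalize (Real.cos θ * Real.sin θ) ^ N = t
  field_simp

/-! ### Uniformly distributed directions in three dimensions -/

section Directions

open MeasureTheory Metric
open scoped ENNReal RealInnerProductSpace

/-- Three-dimensional Euclidean space, as the space of Bloch vectors `(z, x + i y)`. -/
abbrev Bloch := WithLp 2 (ℝ × ℂ)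

/-- The uniform distribution on the unit ball. -/
noncomputable def ballMeasure : Measure Bloch := ProbabilityTheory.cond volume (ball 0 1)

/-- The direction of a vector. -/
noncomputable def direction (x : Bloch) : Bloch := ‖x‖⁻¹ • x

instance : IsProbabilityMeasure ballMeasure :=
  ProbabilityTheory.cond_isProbabilityMeasure_of_finite
    (measure_ball_pos volume _ one_pos).ne' measure_ball_lt_top.ne

theorem measurable_direction : Measurable direction := by
  unfold direction
  fun_prop

theorem norm_direction_le (x : Bloch) : ‖direction x‖ ≤ 1 := by
  rw [direction, norm_smul, norm_inv, norm_norm]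
  exact inv_mul_le_one

theorem direction_map (L : Bloch ≃ₗᵢ[ℝ] Bloch) (x : Bloch) :
    direction (L x) = L (direction x) := by
  simp [direction]

theorem ballMeasure_measurePreserving (L : Bloch ≃ₗᵢ[ℝ] Bloch) :
    MeasurePreserving L ballMeasure ballMeasure := by
  have h : L ⁻¹' ball 0 1 = ball 0 1 := by
    ext x; simp
  have h1 := L.measurePreserving.restrict_preimage (s := ball (0 : Bloch) 1) measurableSet_ball
  rw [h] at h1
  exact h1.smul_measure _

/-- The solid cone is sliced at height `z`. The slice is a disc of squared radius `z² (1/h² - 1)`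
for `z ≤ h`, where the cone is the binding constraint, and `1 - z²` for `z > h`, where the ball is.
-/
theorem volume_cap {h : ℝ} (h0 : 0 < h) (h1 : h < 1) :
    volume {x : Bloch | ‖x‖ < 1 ∧ h * ‖x‖ < x.fst} =
      ENNReal.ofReal (2 * Real.pi / 3 * (1 - h)) := by
  set S : Set (ℝ × ℂ) := {p | p.1 ^ 2 + ‖p.2‖ ^ 2 < 1 ∧ 0 < p.1 ∧
    h ^ 2 * (p.1 ^ 2 + ‖p.2‖ ^ 2) < p.1 ^ 2} with hS
  have hSm : MeasurableSet S := by
    simp only [hS, measurableSet_setOfPred]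
    fun_prop
  have hpre : {x : Bloch | ‖x‖ < 1 ∧ h * ‖x‖ < x.fst} = WithLp.ofLp ⁻¹' S := by
    ext x
    have hn : ‖x‖ ^ 2 = x.fst ^ 2 + ‖x.snd‖ ^ 2 := by
      rw [WithLp.prod_norm_sq_eq_of_L2]; simp
    simp only [Set.mem_ofPred_eq, Set.mem_preimage, hS, WithLp.ofLp_fst, WithLp.ofLp_snd, ← hn]
    have hx := norm_nonneg x
    rw [sq_lt_one_iff₀ hx, ← mul_pow]
    refine and_congr_right fun _ => ⟨fun hh => ?_, fun ⟨hz, hh⟩ => ?_⟩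
    · have : 0 ≤ h * ‖x‖ := by positivity
      exact ⟨lt_of_le_of_lt this hh, pow_lt_pow_left₀ hh this two_ne_zero⟩
    · exact lt_of_pow_lt_pow_left₀ 2 hz.le hh
  rw [hpre, (WithLp.volume_preserving_ofLp ℝ ℂ).measure_preimage hSm.nullMeasurableSet,
    Measure.volume_eq_prod, Measure.prod_apply hSm]
  have hsec : ∀ z : ℝ, volume (Prod.mk z ⁻¹' S) =
      (Set.Ioc 0 h).indicator
        (fun z => ENNReal.ofReal (Real.pi * (z ^ 2 * (1 / h ^ 2 - 1)))) z +
      (Set.Ioc h 1).indicator (fun z => ENNReal.ofReal (Real.pi * (1 - z ^ 2))) z := by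
    have hball : ∀ r : ℝ, 0 ≤ r → volume {w : ℂ | ‖w‖ ^ 2 < r} = ENNReal.ofReal (Real.pi * r) := by
      intro r hr
      have : {w : ℂ | ‖w‖ ^ 2 < r} = ball 0 (√r) := by
        ext w; simp [Real.lt_sqrt (norm_nonneg w)]
      rw [this, Complex.volume_ball, ← ENNReal.ofReal_pow (Real.sqrt_nonneg _), Real.sq_sqrt hr,
        mul_comm, ENNReal.ofReal_mul Real.pi_pos.le]
      congr 1
      rw [← NNReal.coe_real_pi, ENNReal.ofReal_coe_nnreal]
    have hh2 : 0 < h ^ 2 := by positivity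
    have hinv : 1 < 1 / h ^ 2 := by
      rw [lt_div_iff₀ hh2]; nlinarith
    intro z
    by_cases hz0 : z ≤ 0
    · have : Prod.mk z ⁻¹' S = ∅ := by
        ext w; simp [hS]; intro _ h; linarith
      rw [this, measure_empty, Set.indicator_of_notMem, Set.indicator_of_notMem, add_zero] <;>
        simp <;> intro <;> linarith
    push Not at hz0
    by_cases hzh : z ≤ h
    · have : Prod.mk z ⁻¹' S = {w : ℂ | ‖w‖ ^ 2 < z ^ 2 * (1 / h ^ 2 - 1)} := by
        ext w
        simp only [hS, Set.mem_preimage, Set.mem_ofPred_eq]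
        have e : z ^ 2 * (1 / h ^ 2 - 1) = (z ^ 2 - h ^ 2 * z ^ 2) / h ^ 2 := by
          field_simp
        rw [e, lt_div_iff₀ hh2]
        constructor
        · rintro ⟨_, _, h3⟩; linarith
        · intro h3
          refine ⟨?_, hz0, by linarith⟩
          by_contra hcon
          push Not at hcon
          nlinarith
      rw [this, hball _ (by have := sq_nonneg z; nlinarith),
        Set.indicator_of_mem (Set.mem_Ioc.mpr ⟨hz0, hzh⟩), Set.indicator_of_notMem, add_zero]
      simp; intro; linarith
    push Not at hzh
    rw [Set.indicator_of_notMem (by simp; intro; linarith), zero_add]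
    by_cases hz1 : z ≤ 1
    · have : Prod.mk z ⁻¹' S = {w : ℂ | ‖w‖ ^ 2 < 1 - z ^ 2} := by
        ext w
        simp only [hS, Set.mem_preimage, Set.mem_ofPred_eq]
        constructor
        · rintro ⟨h3, _, _⟩; linarith
        · intro h3
          refine ⟨by linarith, hz0, ?_⟩
          nlinarith
      rw [this, hball _ (by nlinarith), Set.indicator_of_mem (Set.mem_Ioc.mpr ⟨hzh, hz1⟩)]
    · push Not at hz1
      have : Prod.mk z ⁻¹' S = ∅ := by
        ext w; simp [hS]; intro h3; nlinarith [sq_nonneg ‖w‖]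
      rw [this, measure_empty, Set.indicator_of_notMem]
      simp; intro; linarith
  have hint : ∀ (f : ℝ → ℝ) (a b : ℝ), a ≤ b → Continuous f → (∀ z ∈ Set.Ioc a b, 0 ≤ f z) →
      ∫⁻ z in Set.Ioc a b, ENNReal.ofReal (f z) = ENNReal.ofReal (∫ z in a..b, f z) := by
    intro f a b hab hf hf0
    rw [intervalIntegral.integral_of_le hab, ofReal_integral_eq_lintegral_ofReal]
    · exact (hf.integrableOn_Icc (a := a) (b := b)).mono_set Set.Ioc_subset_Icc_self
    · exact (ae_restrict_iff' measurableSet_Ioc).mpr (Filter.Eventually.of_forall hf0)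
  have hinv : 0 ≤ 1 / h ^ 2 - 1 := by
    rw [sub_nonneg, le_div_iff₀ (by positivity)]; nlinarith
  simp only [hsec]
  rw [lintegral_add_left (Measurable.indicator (by fun_prop) measurableSet_Ioc),
    lintegral_indicator measurableSet_Ioc, lintegral_indicator measurableSet_Ioc,
    hint _ _ _ h0.le (by fun_prop) (fun z _ => by have := Real.pi_pos; positivity),
    hint _ _ _ h1.le (by fun_prop)
      (fun z hz => mul_nonneg Real.pi_pos.le (by nlinarith [hz.1, hz.2])),
    ← ENNReal.ofReal_add]
  · congr 1
    simp only [intervalIntegral.integral_const_mul, intervalIntegral.integral_mul_const]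
    rw [intervalIntegral.integral_sub (by simp) (by simp)]
    simp only [integral_pow, intervalIntegral.integral_const, smul_eq_mul]
    field_simp
    ring
  · exact intervalIntegral.integral_nonneg h0.le fun z _ => by have := Real.pi_pos; positivity
  · exact intervalIntegral.integral_nonneg h1.le fun z hz =>
      mul_nonneg Real.pi_pos.le (by nlinarith [hz.1, hz.2])

theorem abs_fst_direction_le (x : Bloch) : |(direction x).fst| ≤ 1 := by
  have h := norm_direction_le x
  have hn : ‖direction x‖ ^ 2 = (direction x).fst ^ 2 + ‖(direction x).snd‖ ^ 2 := by
    rw [WithLp.prod_norm_sq_eq_of_L2]; simp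
  rw [← sq_le_one_iff_abs_le_one]
  nlinarith [norm_nonneg (direction x), sq_nonneg ‖(direction x).snd‖]

theorem measurable_fst_direction : Measurable fun x => (direction x).fst :=
  (show Measurable fun x : Bloch => x.fst by fun_prop).comp measurable_direction

theorem measureReal_cap {h : ℝ} (h0 : 0 < h) (h1 : h < 1) :
    ballMeasure.real {x | h < (direction x).fst} = (1 - h) / 2 := by
  have hball : volume (ball (0 : Bloch) 1) = ENNReal.ofReal (4 * Real.pi / 3) := by
    have hfr : Module.finrank ℝ Bloch = 2 * 1 + 1 := by
      rw [(WithLp.linearEquiv 2 ℝ (ℝ × ℂ)).finrank_eq]; simp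
    rw [InnerProductSpace.volume_ball_of_dim_odd hfr, hfr]
    norm_num [Nat.doubleFactorial]
    congr 1
    ring
  have hset : ball (0 : Bloch) 1 ∩ {x | h < (direction x).fst} =
      {x : Bloch | ‖x‖ < 1 ∧ h * ‖x‖ < x.fst} := by
    ext x
    simp only [Set.mem_inter_iff, mem_ball_zero_iff, Set.mem_ofPred_eq]
    refine and_congr_right fun _ => ?_
    rcases eq_or_ne x 0 with rfl | hx
    · simp [direction, h0.le]
    · have hx' : 0 < ‖x‖ := norm_pos_iff.mpr hx
      rw [direction, WithLp.smul_fst, smul_eq_mul, inv_mul_eq_div, lt_div_iff₀ hx']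
  rw [measureReal_def, ballMeasure, ProbabilityTheory.cond_apply measurableSet_ball, hset,
    volume_cap h0 h1, hball, ENNReal.toReal_mul, ENNReal.toReal_inv,
    ENNReal.toReal_ofReal (by positivity), ENNReal.toReal_ofReal]
  · have := Real.pi_pos
    field_simp
    ring
  · have := Real.pi_pos
    have := sub_pos.mpr h1
    positivity

/-- The cap formula covers thresholds in `(0, 1)`. Monotone approximation reaches the closed
half-line and the endpoints, and the symmetry `x ↦ -x` handles negative thresholds. -/
theorem measureReal_Ici_fst_direction {k : ℝ} (hk0 : -1 ≤ k) (hk1 : k ≤ 1) :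
    ballMeasure.real {x | k ≤ (direction x).fst} = (1 - k) / 2 := by
  have hm := measurable_fst_direction
  have hG : ∀ k : ℝ, 0 < k → k ≤ 1 →
      ballMeasure.real {x | k ≤ (direction x).fst} = (1 - k) / 2 := by
    intro k h0 h1
    refine le_antisymm ?_ ?_
    · refine le_of_forall_pos_lt_add fun ε hε => ?_
      -- This threshold is positive, below `k` and within `ε` of it, so the cap formula applies.
      have hlt : max (k / 2) (k - ε) < k := max_lt (by linarith) (by linarith)
      have hpos : 0 < max (k / 2) (k - ε) := lt_max_of_lt_left (by linarith)
      have := measureReal_cap hpos (hlt.trans_le h1)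
      have hle : ballMeasure.real {x | k ≤ (direction x).fst} ≤
          ballMeasure.real {x | max (k / 2) (k - ε) < (direction x).fst} :=
        measureReal_mono fun x hx => hlt.trans_le hx
      linarith [le_max_right (k / 2) (k - ε)]
    · rcases h1.eq_or_lt with rfl | h1
      · simp
      · rw [← measureReal_cap h0 h1]
        exact measureReal_mono fun x (hx : k < _) => hx.le
  have hsymm : ∀ k : ℝ, ballMeasure.real {x | (direction x).fst < -k} =
      ballMeasure.real {x | k < (direction x).fst} := by
    intro k
    have hp := ballMeasure_measurePreserving (LinearIsometryEquiv.neg ℝ)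
    have := hp.measureReal_preimage (s := {x | k < (direction x).fst})
      (measurableSet_lt measurable_const hm).nullMeasurableSet
    rw [← this]
    congr 1
    ext x
    simp only [Set.mem_preimage, Set.mem_ofPred_eq, direction_map]
    simp [lt_neg]
  have hcompl : ∀ k : ℝ, ballMeasure.real {x | -k ≤ (direction x).fst} =
      1 - ballMeasure.real {x | k < (direction x).fst} := by
    intro k
    rw [← hsymm, ← probReal_compl_eq_one_sub (measurableSet_lt hm measurable_const)]
    congr 1
    ext x; simp
  rcases lt_trichotomy k 0 with hk | rfl | hk
  · rw [← neg_neg k, hcompl]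
    rcases hk0.eq_or_lt with rfl | hk0
    · have : {x | - -1 < (direction x).fst} = ∅ := by
        ext x
        have := (abs_le.mp (abs_fst_direction_le x)).2
        simpa using this
      rw [this]; simp
    · rw [measureReal_cap (by linarith) (by linarith)]
      ring
  · have h1 := hcompl 0
    have hlow : 1 / 2 ≤ ballMeasure.real {x | 0 < (direction x).fst} := by
      refine le_of_forall_pos_le_add fun ε hε => ?_
      have hmin : 0 < min ε (1 / 2) := by positivity
      have := measureReal_cap hmin (lt_of_le_of_lt (min_le_right _ _) (by norm_num))
      have hle : ballMeasure.real {x | min ε (1 / 2) < (direction x).fst} ≤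
          ballMeasure.real {x | 0 < (direction x).fst} :=
        measureReal_mono fun x hx => hmin.trans hx
      linarith [min_le_left ε (1 / 2)]
    have hle : ballMeasure.real {x | 0 < (direction x).fst} ≤
        ballMeasure.real {x | -0 ≤ (direction x).fst} :=
      measureReal_mono fun x hx => by
        simp only [neg_zero, Set.mem_ofPred_eq] at hx ⊢
        exact hx.le
    rw [neg_zero] at h1 hle
    linarith
  · exact hG k hk hk1

/-- Archimedes: a coordinate of a uniformly distributed direction is uniformly distributed. -/
theorem map_fst_direction :
    ballMeasure.map (fun x => (direction x).fst) =
      (2⁻¹ : ℝ≥0∞) • volume.restrict (Set.Icc (-1) 1) := by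
  have hm := measurable_fst_direction
  have : IsProbabilityMeasure (ballMeasure.map fun x => (direction x).fst) :=
    Measure.isProbabilityMeasure_map hm.aemeasurable
  refine Measure.ext_of_Ici _ _ fun a => ?_
  rw [Measure.map_apply hm measurableSet_Ici, Measure.smul_apply,
    Measure.restrict_apply measurableSet_Ici, smul_eq_mul]
  have key : ∀ k : ℝ, -1 ≤ k → k ≤ 1 →
      ballMeasure ((fun x => (direction x).fst) ⁻¹' Set.Ici k) =
        2⁻¹ * volume (Set.Ici k ∩ Set.Icc (-1) 1) := by
    intro k h0 h1
    have e : Set.Ici k ∩ Set.Icc (-1) 1 = Set.Icc k 1 := by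
      ext t; simp; intro h _; exact h0.trans h
    have := measureReal_Ici_fst_direction h0 h1
    rw [measureReal_def] at this
    rw [e, Real.volume_Icc]
    change ballMeasure {x | k ≤ (direction x).fst} = _
    rw [← ENNReal.ofReal_toReal (measure_ne_top ballMeasure {x | k ≤ (direction x).fst}), this,
      div_eq_inv_mul, ENNReal.ofReal_mul (by norm_num), ENNReal.ofReal_inv_of_pos two_pos]
    simp
  rcases lt_or_ge 1 a with ha | ha
  · have e1 : (fun x => (direction x).fst) ⁻¹' Set.Ici a = ∅ := by
      ext x
      have := (abs_le.mp (abs_fst_direction_le x)).2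
      simp; linarith
    have e2 : Set.Ici a ∩ Set.Icc (-1) 1 = ∅ := by
      ext t; simp; intros; linarith
    rw [e1, e2]; simp
  rcases le_or_gt (-1) a with ha' | ha'
  · exact key a ha' ha
  · have e1 : (fun x => (direction x).fst) ⁻¹' Set.Ici a =
        (fun x => (direction x).fst) ⁻¹' Set.Ici (-1) := by
      ext x
      have := (abs_le.mp (abs_fst_direction_le x)).1
      simp [this]; linarith
    have e2 : Set.Ici a ∩ Set.Icc (-1) 1 = Set.Ici (-1) ∩ Set.Icc (-1) 1 := by
      ext t; simp; intros; linarith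
    rw [e1, e2]
    exact key _ le_rfl (by norm_num)

theorem integral_comp_inner_direction {e : Bloch} (he : ‖e‖ = 1) {g : ℝ → ℝ}
    (hg : Measurable g) :
    ∫ x, g ⟪e, direction x⟫ ∂ballMeasure = (∫ t in (-1 : ℝ)..1, g t) / 2 := by
  set e₀ : Bloch := WithLp.toLp 2 (1, 0) with he₀
  have hn : ‖e₀‖ = 1 := by
    rw [← sq_eq_sq₀ (norm_nonneg _) zero_le_one, WithLp.prod_norm_sq_eq_of_L2]; simp [he₀]
  have hinner : ∀ x : Bloch, ⟪e₀, x⟫ = x.fst := by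
    intro x; simp [he₀, WithLp.prod_inner_apply]
  -- The reflection exchanging two unit vectors moves the first coordinate axis to `e` and preserves
  -- the measure.
  obtain ⟨L, hL⟩ : ∃ L : Bloch ≃ₗᵢ[ℝ] Bloch, L e₀ = e :=
    ⟨_, Submodule.reflection_sub (hn.trans he.symm)⟩
  have h1 : ∫ x, g ⟪e, direction x⟫ ∂ballMeasure = ∫ x, g (direction x).fst ∂ballMeasure := by
    rw [← (ballMeasure_measurePreserving L).integral_comp L.toMeasurableEquiv.measurableEmbedding]
    simp only [direction_map, ← hL, LinearIsometryEquiv.inner_map_map, hinner]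
  rw [h1, ← integral_map (φ := fun x => (direction x).fst) (f := g)
    measurable_fst_direction.aemeasurable hg.aestronglyMeasurable, map_fst_direction,
    integral_smul_measure, intervalIntegral.integral_of_le (by norm_num),
    integral_Icc_eq_integral_Ioc]
  simp
  ring

/-! ### Moments of threshold functions of a random direction -/

theorem measurable_real_sign : Measurable Real.sign := by
  unfold Real.sign
  exact Measurable.ite measurableSet_Iio measurable_const
    (Measurable.ite measurableSet_Ioi measurable_const measurable_const)

theorem abs_real_sign_le (r : ℝ) : |Real.sign r| ≤ 1 := by
  rcases Real.sign_apply_eq r with h | h | h <;> simp [h]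

theorem integral_mul_sign {h : ℝ} (h0 : -1 ≤ h) (h1 : h ≤ 1) {f : ℝ → ℝ} (hf : Continuous f) :
    ∫ t in (-1 : ℝ)..1, f t * Real.sign (t - h) =
      (∫ t in h..1, f t) - ∫ t in (-1)..h, f t := by
  have hi : ∀ a b, IntervalIntegrable (fun t => f t * Real.sign (t - h)) volume a b := by
    intro a b
    rw [intervalIntegrable_iff]
    refine (intervalIntegrable_iff.mp (hf.intervalIntegrable a b)).mul_bdd (c := 1) ?_ ?_
    · exact (measurable_real_sign.comp (measurable_id.sub_const h)).aestronglyMeasurable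
    · exact Filter.Eventually.of_forall fun t => abs_real_sign_le _
  rw [← intervalIntegral.integral_add_adjacent_intervals (hi (-1) h) (hi h 1), add_comm,
    sub_eq_add_neg, ← intervalIntegral.integral_neg]
  congr 1
  · refine intervalIntegral.integral_congr_ae (Filter.Eventually.of_forall fun t ht => ?_)
    rw [Set.uIoc_of_le h1] at ht
    rw [Real.sign_of_pos (sub_pos.mpr ht.1), mul_one]
  · refine intervalIntegral.integral_congr_ae ?_
    have : ∀ᵐ t : ℝ, t ≠ h := by simp [ae_iff]
    filter_upwards [this] with t hth ht
    rw [Set.uIoc_of_le h0] at ht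
    rw [Real.sign_of_neg (sub_neg.mpr (lt_of_le_of_ne ht.2 hth)), mul_neg, mul_one]

theorem measurable_sign_inner (v : Bloch) (c : ℝ) :
    Measurable fun x => Real.sign (⟪v, direction x⟫ - c) :=
  measurable_real_sign.comp ((measurable_direction.const_inner).sub_const c)

theorem integrable_direction : Integrable direction ballMeasure :=
  Integrable.of_bound measurable_direction.aestronglyMeasurable 1
    (Filter.Eventually.of_forall norm_direction_le)

theorem integrable_sign_smul_direction (v : Bloch) (c : ℝ) :
    Integrable (fun x => Real.sign (⟪v, direction x⟫ - c) • direction x) ballMeasure := by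
  refine Integrable.of_bound
    ((measurable_sign_inner v c).smul measurable_direction).aestronglyMeasurable 1
    (Filter.Eventually.of_forall fun x => ?_)
  rw [norm_smul]
  exact mul_le_one₀ (abs_real_sign_le _) (norm_nonneg _) (norm_direction_le x)

theorem integral_direction : ∫ x, direction x ∂ballMeasure = 0 := by
  have h := (ballMeasure_measurePreserving (LinearIsometryEquiv.neg ℝ)).integral_comp
    (LinearIsometryEquiv.neg ℝ (E := Bloch)).toMeasurableEquiv.measurableEmbedding direction
  have hneg : ∀ x, direction (LinearIsometryEquiv.neg ℝ x) = -direction x := fun x => by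
    rw [direction_map]; rfl
  simp only [hneg, integral_neg] at h
  have h2 : (2 : ℝ) • ∫ x, direction x ∂ballMeasure = 0 := by
    rw [two_smul]
    nth_rewrite 1 [← h]
    exact neg_add_cancel _
  exact (smul_eq_zero.mp h2).resolve_left two_ne_zero

theorem sign_inner_direction {v : Bloch} (hv : v ≠ 0) (h : ℝ) (x : Bloch) :
    Real.sign (⟪v, direction x⟫ - h * ‖v‖) = Real.sign (⟪‖v‖⁻¹ • v, direction x⟫ - h) := by
  have hv' : 0 < ‖v‖ := norm_pos_iff.mpr hv
  have : ⟪v, direction x⟫ - h * ‖v‖ = (⟪‖v‖⁻¹ • v, direction x⟫ - h) * ‖v‖ := by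
    rw [real_inner_smul_left]; field_simp
  rw [this]
  rcases lt_trichotomy (⟪‖v‖⁻¹ • v, direction x⟫ - h) 0 with hh | hh | hh
  · rw [Real.sign_of_neg hh, Real.sign_of_neg (mul_neg_of_neg_of_pos hh hv')]
  · rw [hh, zero_mul]
  · rw [Real.sign_of_pos hh, Real.sign_of_pos (mul_pos hh hv')]

theorem integral_sign_inner {v : Bloch} (hv : v ≠ 0) {h : ℝ} (h0 : -1 ≤ h) (h1 : h ≤ 1) :
    ∫ x, Real.sign (⟪v, direction x⟫ - h * ‖v‖) ∂ballMeasure = -h := by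
  simp only [sign_inner_direction hv]
  have he : ‖‖v‖⁻¹ • v‖ = 1 := norm_smul_inv_norm (𝕜 := ℝ) hv
  rw [integral_comp_inner_direction he (g := fun t => Real.sign (t - h))
    (measurable_real_sign.comp (measurable_id.sub_const h))]
  have := integral_mul_sign h0 h1 (f := fun _ => 1) continuous_const
  simp only [one_mul, intervalIntegral.integral_const, smul_eq_mul, mul_one] at this
  rw [this]
  ring

/-- The integrand is equivariant under reflection in the line `ℝ v`, so the integral lies on that
line. Its component along `v` is a one-dimensional integral by Archimedes' theorem. -/
theorem integral_sign_smul_direction {v : Bloch} (hv : v ≠ 0) {h : ℝ} (h0 : -1 ≤ h)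
    (h1 : h ≤ 1) :
    ∫ x, Real.sign (⟪v, direction x⟫ - h * ‖v‖) • direction x ∂ballMeasure =
      ((1 - h ^ 2) / 2 * ‖v‖⁻¹) • v := by
  set I := ∫ x, Real.sign (⟪v, direction x⟫ - h * ‖v‖) • direction x ∂ballMeasure with hI
  set L := (ℝ ∙ v).reflection with hL
  have hLv : L v = v :=
    Submodule.reflection_mem_subspace_eq_self (Submodule.mem_span_singleton_self v)
  have hfix : L I = I := by
    calc L I = ∫ x, L (Real.sign (⟪v, direction x⟫ - h * ‖v‖) • direction x) ∂ballMeasure := by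
          rw [hI]
          exact (L.toContinuousLinearEquiv.toContinuousLinearMap.integral_comp_comm
            (integrable_sign_smul_direction v _)).symm
      _ = ∫ x, Real.sign (⟪v, direction (L x)⟫ - h * ‖v‖) • direction (L x) ∂ballMeasure := by
          refine integral_congr_ae (Filter.Eventually.of_forall fun x => ?_)
          have : ⟪v, L (direction x)⟫ = ⟪v, direction x⟫ := by
            conv_lhs => rw [← hLv]
            exact L.inner_map_map _ _
          simp only [direction_map, this, map_smul]
      _ = I := (ballMeasure_measurePreserving L).integral_comp
          L.toMeasurableEquiv.measurableEmbedding
          (fun x => Real.sign (⟪v, direction x⟫ - h * ‖v‖) • direction x)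
  obtain ⟨c, hc⟩ := Submodule.mem_span_singleton.mp ((Submodule.reflection_eq_self_iff I).mp hfix)
  have hv' : 0 < ‖v‖ := norm_pos_iff.mpr hv
  have he : ‖‖v‖⁻¹ • v‖ = 1 := norm_smul_inv_norm (𝕜 := ℝ) hv
  have hin : ⟪‖v‖⁻¹ • v, I⟫ = (1 - h ^ 2) / 2 := by
    rw [hI, ← integral_inner (integrable_sign_smul_direction v _)]
    simp only [real_inner_smul_right, sign_inner_direction hv]
    have hm : Measurable fun t : ℝ => Real.sign (t - h) * t :=
      (measurable_real_sign.comp (measurable_id.sub_const h)).mul measurable_id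
    rw [integral_comp_inner_direction he (g := fun t => Real.sign (t - h) * t) hm]
    have := integral_mul_sign h0 h1 (f := fun t => t) continuous_id
    simp only [mul_comm (Real.sign _), this, integral_id]
    ring
  rw [← hc, real_inner_smul_right, real_inner_smul_left, real_inner_self_eq_norm_sq] at hin
  rw [← hc]
  congr 1
  field_simp at hin ⊢
  exact hin

/-- The deviation from `1/2` of the probability of the outcome with Bloch vector `v` and bias
`-h`, given the hidden variable `x`. -/
noncomputable def oddResponse (v : Bloch) (h : ℝ) (x : Bloch) : ℝ :=
  ‖v‖ / (1 - h ^ 2) * Real.sign (⟪v, direction x⟫ - h * ‖v‖) -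
    (1 - 2 * ‖v‖ / (1 - h ^ 2)) * (h / 2)

theorem measurable_oddResponse (v : Bloch) (h : ℝ) : Measurable (oddResponse v h) :=
  ((measurable_sign_inner v _).const_mul _).sub_const _

/-- This oddness is what makes the responses to two complementary rank-one projections add up to 1.
-/
theorem oddResponse_neg (v : Bloch) (h : ℝ) (x : Bloch) :
    oddResponse (-v) (-h) x = -oddResponse v h x := by
  have : ⟪-v, direction x⟫ - -h * ‖-v‖ = -(⟪v, direction x⟫ - h * ‖v‖) := by
    rw [inner_neg_left, norm_neg]; ring
  rw [oddResponse, oddResponse, this, Real.sign_neg, norm_neg, neg_sq]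
  ring

theorem oddResponse_zero (x : Bloch) : oddResponse 0 0 x = 0 := by
  simp [oddResponse]

/-- With `η = ‖v‖ / (1 - h²)`, adding `1/2` gives the mixture of the threshold answer `(1 + sign)/2`
with weight `2η` and the constant `(1 - h)/2` with weight `1 - 2η`. The hypothesis yields `2η ≤ 1`.
If `h² = 1` then `v = 0`, and division by zero gives `η = 0`, as wanted. -/
theorem abs_oddResponse_le {v : Bloch} {h : ℝ} (hvh : h ^ 2 + 2 * ‖v‖ ≤ 1) (x : Bloch) :
    |oddResponse v h x| ≤ 1 / 2 := by
  have hv := norm_nonneg v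
  have hh : |h| ≤ 1 := by rw [← sq_le_one_iff_abs_le_one]; linarith
  have hη0 : 0 ≤ ‖v‖ / (1 - h ^ 2) := div_nonneg hv (by linarith)
  have hη1 : ‖v‖ / (1 - h ^ 2) ≤ 1 / 2 :=
    div_le_of_le_mul₀ (by linarith) (by norm_num) (by linarith)
  have hs := abs_le.mp (abs_real_sign_le (⟪v, direction x⟫ - h * ‖v‖))
  have hh' := abs_le.mp hh
  rw [oddResponse, mul_div_assoc]
  generalize ‖v‖ / (1 - h ^ 2) = η at *
  generalize Real.sign (⟪v, direction x⟫ - h * ‖v‖) = s at *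
  rw [abs_le]
  constructor <;>
    nlinarith [mul_nonneg hη0 (sub_nonneg.mpr hs.1), mul_nonneg hη0 (sub_nonneg.mpr hs.2)]

theorem integral_oddResponse {v : Bloch} {h : ℝ} (hvh : h ^ 2 + 2 * ‖v‖ ≤ 1) :
    ∫ x, oddResponse v h x ∂ballMeasure = -h / 2 := by
  have hh : |h| ≤ 1 := by
    rw [← sq_le_one_iff_abs_le_one]; linarith [norm_nonneg v]
  rcases eq_or_ne v 0 with rfl | hv
  · simp [oddResponse]; ring
  · unfold oddResponse
    rw [integral_sub, integral_const_mul, integral_sign_inner hv (abs_le.mp hh).1 (abs_le.mp hh).2]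
    · simp; ring
    · exact (Integrable.of_bound (measurable_sign_inner v _).aestronglyMeasurable 1
        (Filter.Eventually.of_forall fun x => abs_real_sign_le _)).const_mul _
    · exact integrable_const _

theorem integral_oddResponse_smul_direction {v : Bloch} {h : ℝ} (hvh : h ^ 2 + 2 * ‖v‖ ≤ 1) :
    ∫ x, oddResponse v h x • direction x ∂ballMeasure = (1 / 2 : ℝ) • v := by
  have hh : |h| ≤ 1 := by
    rw [← sq_le_one_iff_abs_le_one]; linarith [norm_nonneg v]
  rcases eq_or_ne v 0 with rfl | hv
  · simp [oddResponse, integral_neg, integral_smul, integral_direction]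
  · have hv' : 0 < ‖v‖ := norm_pos_iff.mpr hv
    have hpos : 0 < 1 - h ^ 2 := by linarith
    simp only [oddResponse, sub_smul, mul_smul (‖v‖ / (1 - h ^ 2))]
    rw [integral_sub, integral_smul, integral_smul, integral_direction,
      integral_sign_smul_direction hv (abs_le.mp hh).1 (abs_le.mp hh).2, smul_zero, sub_zero,
      smul_smul]
    · congr 1
      field_simp
    · exact (integrable_sign_smul_direction v _).fun_smul (‖v‖ / (1 - h ^ 2))
    · exact integrable_direction.fun_smul _

end Directions

/-! ### The response functions for a single copy -/

section Response

open MeasureTheory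
open scoped RealInnerProductSpace

/-- The off-diagonal entry of `P² = P` reads `P₁₀ (tr P - 1) = 0`: either `P` is diagonal with
entries 0 or 1, or it has trace 1 and a Bloch vector of unit length. -/
theorem projection_cases {P : Matrix (Fin 2) (Fin 2) ℂ} (hP : P.IsHermitian)
    (hi : P * P = P) :
    P = 0 ∨ P = 1 ∨
      (P.trace = 1 ∧ (P 0 0 - P 1 1).re ^ 2 + ‖2 * P 1 0‖ ^ 2 = 1) := by
  have h00 := congrFun (congrFun hi 0) 0
  have h11 := congrFun (congrFun hi 1) 1
  have h10 := congrFun (congrFun hi 1) 0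
  have hw : P 0 1 = star (P 1 0) := (hP.apply 0 1).symm
  obtain ⟨p, hp⟩ : ∃ p : ℝ, P 0 0 = p :=
    ⟨(P 0 0).re, (Complex.conj_eq_iff_re.mp (hP.apply 0 0)).symm⟩
  obtain ⟨q, hq⟩ : ∃ q : ℝ, P 1 1 = q :=
    ⟨(P 1 1).re, (Complex.conj_eq_iff_re.mp (hP.apply 1 1)).symm⟩
  simp only [Matrix.mul_apply, Fin.sum_univ_two, hw, hp, hq, Complex.star_def] at h00 h11 h10
  rw [mul_comm, mul_comm (starRingEnd ℂ _)] at h00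
  rw [Complex.mul_conj, Complex.normSq_eq_norm_sq] at h00 h11
  norm_cast at h00 h11
  have h10' : P 1 0 * ((p + q - 1 : ℝ) : ℂ) = 0 := by
    push_cast
    linear_combination h10
  rcases mul_eq_zero.mp h10' with hz | hz
  · simp only [hz, norm_zero] at h00 h11
    have hp' : p = 0 ∨ p = 1 := by
      rcases eq_or_ne p 0 with h | h
      · exact Or.inl h
      · right; apply mul_left_cancel₀ h; linarith
    have hq' : q = 0 ∨ q = 1 := by
      rcases eq_or_ne q 0 with h | h
      · exact Or.inl h
      · right; apply mul_left_cancel₀ h; linarith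
    rcases hp' with rfl | rfl <;> rcases hq' with rfl | rfl
    · left
      ext i j; fin_cases i <;> fin_cases j <;> simp [hp, hq, hz, hw]
    · right; right
      simp [Matrix.trace, Fin.sum_univ_two, hp, hq, hz]
    · right; right
      simp [Matrix.trace, Fin.sum_univ_two, hp, hq, hz]
    · right; left
      ext i j; fin_cases i <;> fin_cases j <;> simp [hp, hq, hz, hw]
  · have hpq : p + q - 1 = 0 := by exact_mod_cast hz
    right; right
    constructor
    · rw [Matrix.trace, Fin.sum_univ_two, Matrix.diag_apply, Matrix.diag_apply, hp, hq]
      norm_cast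
      linarith
    · rw [hp, hq, norm_mul, mul_pow]
      simp only [Complex.sub_re, Complex.ofReal_re, Complex.norm_ofNat]
      have : q = 1 - p := by linarith
      subst this
      nlinarith

/-- The part of the response to the outcome `P` that is odd in the Bloch vector of `P`. -/
noncomputable def oddPart (a tx tz : ℝ) (P : Matrix (Fin 2) (Fin 2) ℂ) (x : Bloch) : ℝ :=
  oddResponse (WithLp.toLp 2 (tz * (P 0 0 - P 1 1).re, tx * (2 * P 1 0)))
    (-(a * (P 0 0 - P 1 1).re)) x

/-- The probability of the outcome `P` given the hidden variable `x`. -/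
noncomputable def response (a tx tz : ℝ) (P : Matrix (Fin 2) (Fin 2) ℂ) (x : Bloch) : ℝ :=
  P.trace.re / 2 + oddPart a tx tz P x

variable {a tx tz : ℝ}

theorem oddPart_zero (x : Bloch) : oddPart a tx tz 0 x = 0 := by
  rw [← oddResponse_zero x, oddPart]
  congr 1 <;> simp

theorem oddPart_one (x : Bloch) : oddPart a tx tz 1 x = 0 := by
  rw [← oddResponse_zero x, oddPart]
  congr 1 <;> simp

theorem oddPart_one_sub (P : Matrix (Fin 2) (Fin 2) ℂ) (x : Bloch) :
    oddPart a tx tz (1 - P) x = -oddPart a tx tz P x := by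
  rw [oddPart, oddPart, ← oddResponse_neg]
  congr 1
  · rw [← WithLp.toLp_neg]
    congr 1
    ext1 <;> simp
    ring
  · simp; ring

theorem response_one (x : Bloch) : response a tx tz 1 x = 1 := by
  rw [response, oddPart_one]
  simp

theorem measurable_response (P : Matrix (Fin 2) (Fin 2) ℂ) : Measurable (response a tx tz P) :=
  (measurable_oddResponse _ _).const_add _

theorem sum_response {k : ℕ} (M : ProjMeas k) (x : Bloch) :
    ∑ i, response a tx tz (M.P i) x = 1 := by
  have htr : ∑ i, (M.P i).trace.re / 2 = 1 := by
    rw [← Finset.sum_div, ← Complex.re_sum, ← Matrix.trace_sum, M.sum_eq_one]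
    simp
  suffices h : ∑ i, oddPart a tx tz (M.P i) x = 0 by
    simp only [response, Finset.sum_add_distrib, htr, h, add_zero]
  -- In dimension two a nontrivial element forces exactly one other nonzero element, its complement,
  -- and their odd parts cancel. Otherwise every element is 0 or 1 and has no odd part.
  by_cases hall : ∃ i, M.P i ≠ 0 ∧ M.P i ≠ 1
  · obtain ⟨i, hi0, hi1⟩ := hall
    have htri : (M.P i).trace = 1 := by
      rcases projection_cases (M.herm i) (M.idem i) with h | h | h
      · exact absurd h hi0
      · exact absurd h hi1
      · exact h.1
    obtain ⟨j, hji, hj0⟩ : ∃ j, j ≠ i ∧ M.P j ≠ 0 := by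
      by_contra! hcon
      refine hi1 ?_
      rw [← M.sum_eq_one]
      exact (Fintype.sum_eq_single i fun j hj => hcon j hj).symm
    have hij := M.orth i j hji.symm
    have hji' := M.orth j i hji
    have hj1 : M.P j ≠ 1 := fun h => hi0 (by rw [h, mul_one] at hij; exact hij)
    have htrj : (M.P j).trace = 1 := by
      rcases projection_cases (M.herm j) (M.idem j) with h | h | h
      · exact absurd h hj0
      · exact absurd h hj1
      · exact h.1
    have hE : 1 - M.P i - M.P j = 0 := by
      have hherm : (1 - M.P i - M.P j).IsHermitian :=
        (Matrix.isHermitian_one.sub (M.herm i)).sub (M.herm j)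
      have hidem : (1 - M.P i - M.P j) * (1 - M.P i - M.P j) = 1 - M.P i - M.P j := by
        simp only [sub_mul, mul_sub, one_mul, mul_one, M.idem, hij, hji']
        abel
      have htrE : (1 - M.P i - M.P j).trace = 0 := by
        rw [Matrix.trace_sub, Matrix.trace_sub, htri, htrj, Matrix.trace_one]
        norm_num
      rcases projection_cases hherm hidem with h | h | h
      · exact h
      · rw [h, Matrix.trace_one] at htrE
        norm_num at htrE
      · rw [h.1] at htrE
        exact absurd htrE one_ne_zero
    have hj : M.P j = 1 - M.P i := (sub_eq_zero.mp hE).symm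
    rw [Fintype.sum_eq_add i j hji.symm, hj, oddPart_one_sub, add_neg_cancel]
    rintro l ⟨hli, hlj⟩
    have : M.P l = 0 := by
      have := congrArg (M.P l * ·) hE
      simpa [mul_sub, M.orth l i hli, M.orth l j hlj] using this
    rw [this, oddPart_zero]
  · push Not at hall
    refine Finset.sum_eq_zero fun i _ => ?_
    rcases eq_or_ne (M.P i) 0 with h | h
    · rw [h, oddPart_zero]
    · rw [hall i h, oddPart_one]

/-- The condition under which the response functions reproduce the assemblage with Bloch
parameters `a`, `tx` and `tz`. -/
def UnsteerableParams (a tx tz : ℝ) : Prop :=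
  ∀ u : ℝ, 0 ≤ u → u ≤ 1 → a ^ 2 * u + 2 * √(tx ^ 2 * (1 - u) + tz ^ 2 * u) ≤ 1

/-- The variable `u` of `UnsteerableParams` is the squared `z`-component of the Bloch vector of a
rank-one `P`; the transverse part then has squared length `1 - u`. -/
theorem UnsteerableParams.norm_le (h : UnsteerableParams a tx tz)
    {P : Matrix (Fin 2) (Fin 2) ℂ} (hP : P.IsHermitian) (hi : P * P = P) :
    (-(a * (P 0 0 - P 1 1).re)) ^ 2 + 2 * ‖(WithLp.toLp 2
      (tz * (P 0 0 - P 1 1).re, tx * (2 * P 1 0)) : Bloch)‖ ≤ 1 := by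
  rcases projection_cases hP hi with rfl | rfl | ⟨-, hn⟩
  · simp
  · simp
  · have hu := h ((P 0 0 - P 1 1).re ^ 2) (sq_nonneg _) (by nlinarith [sq_nonneg ‖2 * P 1 0‖])
    have : ‖(WithLp.toLp 2 (tz * (P 0 0 - P 1 1).re, tx * (2 * P 1 0)) : Bloch)‖ =
        √(tx ^ 2 * (1 - (P 0 0 - P 1 1).re ^ 2) + tz ^ 2 * (P 0 0 - P 1 1).re ^ 2) := by
      rw [← Real.sqrt_sq (norm_nonneg (WithLp.toLp 2 _ : Bloch)), WithLp.prod_norm_sq_eq_of_L2]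
      congr 1
      rw [← hn]
      simp only [WithLp.toLp_fst, WithLp.toLp_snd, norm_mul, Complex.norm_real,
        Real.norm_eq_abs, mul_pow, sq_abs]
      ring
    rw [this]
    linarith [mul_pow a (P 0 0 - P 1 1).re 2, neg_sq (a * (P 0 0 - P 1 1).re)]

theorem response_nonneg (h : UnsteerableParams a tx tz)
    {P : Matrix (Fin 2) (Fin 2) ℂ} (hP : P.IsHermitian) (hi : P * P = P) (x : Bloch) :
    0 ≤ response a tx tz P x := by
  have hb := abs_le.mp (abs_oddResponse_le (h.norm_le hP hi) x)
  rcases projection_cases hP hi with rfl | rfl | ⟨htr, -⟩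
  · simp [response, oddPart_zero]
  · simp [response_one]
  · rw [response, htr, oddPart, Complex.one_re]
    linarith [hb.1]

theorem abs_response_le (h : UnsteerableParams a tx tz)
    {P : Matrix (Fin 2) (Fin 2) ℂ} (hP : P.IsHermitian) (hi : P * P = P) (x : Bloch) :
    |response a tx tz P x| ≤ |P.trace.re / 2| + 1 / 2 :=
  (abs_add_le _ _).trans (add_le_add_right (abs_oddResponse_le (h.norm_le hP hi) x) _)

theorem integrable_response (h : UnsteerableParams a tx tz)
    {P : Matrix (Fin 2) (Fin 2) ℂ} (hP : P.IsHermitian) (hi : P * P = P) :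
    Integrable (response a tx tz P) ballMeasure :=
  Integrable.of_bound (measurable_response P).aestronglyMeasurable _
    (Filter.Eventually.of_forall (abs_response_le h hP hi))

theorem integral_response (h : UnsteerableParams a tx tz)
    {P : Matrix (Fin 2) (Fin 2) ℂ} (hP : P.IsHermitian) (hi : P * P = P) :
    ∫ x, response a tx tz P x ∂ballMeasure =
      (P.trace.re + a * (P 0 0 - P 1 1).re) / 2 := by
  have hint : Integrable (oddPart a tx tz P) ballMeasure :=
    Integrable.of_bound (measurable_oddResponse _ _).aestronglyMeasurable (1 / 2)
      (Filter.Eventually.of_forall (abs_oddResponse_le (h.norm_le hP hi)))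
  unfold response
  rw [integral_add (integrable_const _) hint]
  unfold oddPart
  rw [integral_oddResponse (h.norm_le hP hi)]
  simp
  ring

theorem integral_response_smul_direction (h : UnsteerableParams a tx tz)
    {P : Matrix (Fin 2) (Fin 2) ℂ} (hP : P.IsHermitian) (hi : P * P = P) :
    ∫ x, response a tx tz P x • direction x ∂ballMeasure =
      (1 / 2 : ℝ) • WithLp.toLp 2 (tz * (P 0 0 - P 1 1).re, tx * (2 * P 1 0)) := by
  rw [← integral_oddResponse_smul_direction (h.norm_le hP hi)]
  simp only [response, add_smul]
  rw [integral_add (integrable_direction.fun_smul _), integral_smul, integral_direction,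
    smul_zero, zero_add]
  · rfl
  · exact integrable_direction.bdd_smul (1 / 2) (measurable_oddResponse _ _).aestronglyMeasurable
      (Filter.Eventually.of_forall (abs_oddResponse_le (h.norm_le hP hi)))

theorem integrable_response_smul_direction (h : UnsteerableParams a tx tz)
    {P : Matrix (Fin 2) (Fin 2) ℂ} (hP : P.IsHermitian) (hi : P * P = P) :
    Integrable (fun x => response a tx tz P x • direction x) ballMeasure :=
  integrable_direction.bdd_smul _ (measurable_response P).aestronglyMeasurable
    (Filter.Eventually.of_forall (abs_response_le h hP hi))

theorem integral_response_mul_fst (h : UnsteerableParams a tx tz)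
    {P : Matrix (Fin 2) (Fin 2) ℂ} (hP : P.IsHermitian) (hi : P * P = P) :
    ∫ x, response a tx tz P x * (direction x).fst ∂ballMeasure =
      tz * (P 0 0 - P 1 1).re / 2 := by
  have := fst_integral_withLp (integrable_response_smul_direction h hP hi)
  rw [integral_response_smul_direction h hP hi] at this
  simp only [WithLp.smul_fst, smul_eq_mul, WithLp.toLp_fst] at this
  rw [← this]
  ring

theorem integral_response_mul_snd (h : UnsteerableParams a tx tz)
    {P : Matrix (Fin 2) (Fin 2) ℂ} (hP : P.IsHermitian) (hi : P * P = P) :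
    ∫ x, (response a tx tz P x : ℂ) * (direction x).snd ∂ballMeasure = tx * P 1 0 := by
  have := snd_integral_withLp (integrable_response_smul_direction h hP hi)
  rw [integral_response_smul_direction h hP hi] at this
  simp only [WithLp.smul_snd, Complex.real_smul, WithLp.toLp_snd] at this
  rw [← this]
  push_cast
  ring

end Response

/-! ### The fully local model -/

section Model

open MeasureTheory

/-- The three equations match the bias, the `z`-part and the transverse part of the assemblage after
whitening by the state of B. For `S > 0` the first two determine `a` and `tz`, the third `tx`, with
`D = 1 - α² C² = 4 b₀ b₁`. The steering bound is exactly the required inequality at `u = 1`; an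
AM-GM estimate transfers it to all `u`. -/
theorem exists_unsteerableParams {α C S : ℝ} (hα0 : 0 < α) (hα1 : α ≤ 1) (hC0 : 0 ≤ C)
    (hS0 : 0 ≤ S) (hCS : C ^ 2 + S ^ 2 = 1) (h : steerBound α ≤ C ^ 2) :
    ∃ a tx tz : ℝ, UnsteerableParams a tx tz ∧
      (1 + α * C) / 2 * (a + tz) = (α + C) / 2 ∧
      (1 - α * C) / 2 * (a - tz) = (C - α) / 2 ∧
      √((1 + α * C) / 2 * ((1 - α * C) / 2)) * tx = α * S / 2 := by
  rcases hS0.eq_or_lt with rfl | hS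
  · have hC : C = 1 := by nlinarith
    subst hC
    -- For `S = 0` the state is a product. The general solution is avoided here because `D` vanishes
    -- when `α = 1`.
    refine ⟨1, 0, 0, fun u _ hu => by simpa using hu, by ring, by ring, by ring⟩
  have hw : α ^ 3 * C ^ 2 * (2 - α) ≥ 2 * α - 1 := by
    rw [steerBound, div_le_iff₀ (by have : 0 < 2 - α := by linarith
                                    positivity)] at h
    linarith
  have hS2 : S ^ 2 = 1 - C ^ 2 := by linarith
  have hC1 : C ^ 2 < 1 := by nlinarith
  have hα2 : α ^ 2 ≤ 1 := by nlinarith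
  set D := 1 - α ^ 2 * C ^ 2 with hD
  have hDpos : 0 < D := by nlinarith [sq_nonneg C]
  have hsq : √D ^ 2 = D := Real.sq_sqrt hDpos.le
  have hsD : 0 < √D := Real.sqrt_pos.mpr hDpos
  -- After multiplication by `2 - α`, the steering bound eliminates `C²` and leaves `(1 - α)² (1 +
  -- α) ≥ 0`.
  have hαD : α * D ≤ 1 - α ^ 2 := by
    have h1 : 0 ≤ (1 - α) ^ 2 * (1 + α) := by positivity
    have h2 : 0 < 2 - α := by linarith
    have h3 : 0 ≤ (2 - α) * (1 - α ^ 2 - α * D) := by rw [hD]; nlinarith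
    nlinarith [(mul_nonneg_iff_of_pos_left h2).mp h3]
  refine ⟨C * (1 - α ^ 2) / D, α * S / √D, α * S ^ 2 / D, ?_, ?_, ?_, ?_⟩
  · have htz : 0 < α * S ^ 2 / D := by positivity
    have hone : (C * (1 - α ^ 2) / D) ^ 2 + 2 * (α * S ^ 2 / D) ≤ 1 := by
      have e : 1 - ((C * (1 - α ^ 2) / D) ^ 2 + 2 * (α * S ^ 2 / D)) =
          (1 - C ^ 2) * (1 - 2 * α + α ^ 3 * C ^ 2 * (2 - α)) / D ^ 2 := by
        rw [hS2]
        field_simp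
        rw [hD]
        ring
      have : 0 ≤ (1 - C ^ 2) * (1 - 2 * α + α ^ 3 * C ^ 2 * (2 - α)) / D ^ 2 :=
        div_nonneg (mul_nonneg (by linarith) (by linarith)) (by positivity)
      linarith
    -- This says `tx² - tz² ≤ a² tz`, which reduces to `α D ≤ 1 - α²`.
    have hslope : (α * S / √D) ^ 2 - (α * S ^ 2 / D) ^ 2 ≤
        (C * (1 - α ^ 2) / D) ^ 2 * (α * S ^ 2 / D) := by
      have e : (C * (1 - α ^ 2) / D) ^ 2 * (α * S ^ 2 / D) -
          ((α * S / √D) ^ 2 - (α * S ^ 2 / D) ^ 2) =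
          α * S ^ 2 * C ^ 2 * (1 - α ^ 2) * (1 - α ^ 2 - α * D) / D ^ 3 := by
        rw [div_pow (α * S), hsq]
        field_simp
        have : D - S ^ 2 = C ^ 2 * (1 - α ^ 2) := by rw [hD, hS2]; ring
        linear_combination (-α * D) * this
      have : 0 ≤ α * S ^ 2 * C ^ 2 * (1 - α ^ 2) * (1 - α ^ 2 - α * D) / D ^ 3 :=
        div_nonneg (mul_nonneg (mul_nonneg (by positivity) (by linarith)) (by linarith))
          (by positivity)
      linarith
    generalize C * (1 - α ^ 2) / D = a at *
    generalize α * S ^ 2 / D = z at *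
    generalize α * S / √D = t at *
    intro u hu0 hu1
    -- AM-GM gives `2 √X z ≤ X + z²`, where `X = z² + (t² - z²)(1 - u) ≤ z² + a² z (1 - u)`.
    -- Dividing by `z > 0` bounds the left side at `u` by its value `a² + 2z` at `u = 1`.
    have hamgm : 2 * √(t ^ 2 * (1 - u) + z ^ 2 * u) * z ≤
        (2 * z + a ^ 2 * (1 - u)) * z := by
      have hX : 0 ≤ t ^ 2 * (1 - u) + z ^ 2 * u :=
        add_nonneg (mul_nonneg (sq_nonneg _) (by linarith)) (by positivity)
      nlinarith [Real.sq_sqrt hX, sq_nonneg (√(t ^ 2 * (1 - u) + z ^ 2 * u) - z)]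
    have := le_of_mul_le_mul_right hamgm htz
    linarith
  · field_simp
    rw [hS2, hD]
    ring
  · field_simp
    rw [hS2, hD]
    ring
  · have : (1 + α * C) / 2 * ((1 - α * C) / 2) = D / 2 ^ 2 := by rw [hD]; ring
    rw [this, Real.sqrt_div hDpos.le, Real.sqrt_sq zero_le_two]
    field_simp

/-- The operator on the second qubit that remains of one copy after the outcome `P` on the
first. -/
noncomputable def assemblage (α θ : ℝ) (P : Matrix (Fin 2) (Fin 2) ℂ) (u v : Fin 2) : ℂ :=
  ∑ x : Fin 2, ∑ y : Fin 2, rhoTwo α θ (x, u) (y, v) * P y x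

/-- Before the sum over the filter indices `u` and `v`, the statistics factor over the copies, so a
model of one copy can be inserted in each factor. -/
theorem trace_rhoA_mul_localTensor {N : ℕ} (hN : 1 ≤ N) (α θ : ℝ)
    (P : Fin N → Matrix (Fin 2) (Fin 2) ℂ) :
    (rhoA N α θ * localTensor P).trace =
      (successProb N α θ : ℂ)⁻¹ * ∑ u, ∑ v, ∏ i, assemblage α θ (P i) u v := by
  have h : ∀ u v, ∏ i, assemblage α θ (P i) u v = ∑ x : Fin N → Fin 2, ∑ y : Fin N → Fin 2,
      (∏ i, rhoTwo α θ (x i, u) (y i, v)) * ∏ i, P i (y i) (x i) := by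
    intro u v
    simp only [assemblage, Finset.prod_univ_sum, Fintype.piFinset_univ,
      Finset.prod_mul_distrib]
  rw [rhoA, Matrix.smul_mul, Matrix.trace_smul, trace_filtered hN, smul_eq_mul]
  congr 1
  simp only [Matrix.trace, Matrix.diag_apply, Matrix.mul_apply, traceB_filtered_apply,
    localTensor, Matrix.of_apply, h, Fin.sum_univ_two, ← Finset.sum_add_distrib, add_mul]

/-- The hidden state of the second qubit with Bloch vector `n`, in the frame where its mean has
diagonal entries `b₀` and `b₁`. -/
noncomputable def hiddenState (b₀ b₁ : ℝ) (n : Bloch) : Fin 2 → Fin 2 → ℂ :=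
  ![![((b₀ * (1 + n.fst) : ℝ) : ℂ), ((√(b₀ * b₁) : ℝ) : ℂ) * n.snd],
    ![((√(b₀ * b₁) : ℝ) : ℂ) * starRingEnd ℂ n.snd, ((b₁ * (1 - n.fst) : ℝ) : ℂ)]]

theorem measurable_hiddenState (b₀ b₁ : ℝ) (u v : Fin 2) :
    Measurable fun n => hiddenState b₀ b₁ n u v := by
  fin_cases u <;> fin_cases v <;> simp only [hiddenState, Fin.zero_eta, Fin.mk_one,
    Matrix.cons_val_zero, Matrix.cons_val_one, Matrix.cons_val_fin_one] <;> fun_prop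

theorem norm_hiddenState_le (b₀ b₁ : ℝ) {n : Bloch} (hn : ‖n‖ ≤ 1) (u v : Fin 2) :
    ‖hiddenState b₀ b₁ n u v‖ ≤ 2 * |b₀| + 2 * |b₁| + √(b₀ * b₁) := by
  have hsq : ‖n‖ ^ 2 = n.fst ^ 2 + ‖n.snd‖ ^ 2 := by
    rw [WithLp.prod_norm_sq_eq_of_L2]; simp
  have hn2 : ‖n‖ ^ 2 ≤ 1 := pow_le_one₀ (norm_nonneg _) hn
  have h1 := abs_le.mp (abs_le_one_iff_mul_self_le_one.mpr
    (show n.fst * n.fst ≤ 1 by nlinarith [sq_nonneg ‖n.snd‖]))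
  have h2 : ‖n.snd‖ ≤ 1 := by nlinarith [sq_nonneg n.fst, norm_nonneg n.snd]
  have hs := Real.sqrt_nonneg (b₀ * b₁)
  have e0 : |1 + n.fst| ≤ 2 := abs_le.mpr ⟨by linarith, by linarith⟩
  have e1 : |1 - n.fst| ≤ 2 := abs_le.mpr ⟨by linarith, by linarith⟩
  have p0 := abs_nonneg b₀
  have p1 := abs_nonneg b₁
  fin_cases u <;> fin_cases v
  · simp only [hiddenState, Fin.zero_eta, Matrix.cons_val_zero, Complex.norm_real,
      Real.norm_eq_abs, abs_mul]
    nlinarith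
  · simp only [hiddenState, Fin.zero_eta, Fin.mk_one, Matrix.cons_val_zero, Matrix.cons_val_one,
      Matrix.cons_val_fin_one, Complex.norm_real, Real.norm_eq_abs, norm_mul, abs_of_nonneg hs]
    nlinarith
  · simp only [hiddenState, Fin.zero_eta, Fin.mk_one, Matrix.cons_val_zero, Matrix.cons_val_one,
      Matrix.cons_val_fin_one, Complex.norm_real, Real.norm_eq_abs, norm_mul, abs_of_nonneg hs,
      Complex.norm_conj]
    nlinarith
  · simp only [hiddenState, Fin.mk_one, Matrix.cons_val_one,
      Matrix.cons_val_fin_one, Complex.norm_real, Real.norm_eq_abs, abs_mul]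
    nlinarith

/-- The weight with which a joint hidden state passes the filter. -/
noncomputable def filterWeight {N : ℕ} (b₀ b₁ : ℝ) (l : Fin N → Bloch) : ℝ :=
  ∏ i, (b₀ * (1 + (direction (l i)).fst)) + ∏ i, (b₁ * (1 - (direction (l i)).fst)) +
    2 * (∏ i, (((√(b₀ * b₁) : ℝ) : ℂ) * (direction (l i)).snd)).re

theorem sum_prod_hiddenState {N : ℕ} (b₀ b₁ : ℝ) (l : Fin N → Bloch) :
    ∑ u, ∑ v, ∏ i, hiddenState b₀ b₁ (direction (l i)) u v = (filterWeight b₀ b₁ l : ℂ) := by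
  have hconj : ∏ i, (((√(b₀ * b₁) : ℝ) : ℂ) * starRingEnd ℂ (direction (l i)).snd) =
      starRingEnd ℂ (∏ i, (((√(b₀ * b₁) : ℝ) : ℂ) * (direction (l i)).snd)) := by
    rw [map_prod]
    exact Finset.prod_congr rfl fun i _ => by rw [map_mul, Complex.conj_ofReal]
  simp only [Fin.sum_univ_two, hiddenState, Matrix.cons_val_zero, Matrix.cons_val_one,
    Matrix.cons_val_fin_one, hconj, filterWeight]
  have := Complex.add_conj (∏ i, (((√(b₀ * b₁) : ℝ) : ℂ) * (direction (l i)).snd))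
  push_cast at this ⊢
  linear_combination this

/-- The weight is the expectation of a product of positive operators in `|0⋯0⟩ + |1⋯1⟩`. Concretely,
`‖n‖ ≤ 1` bounds the squared modulus of the coherence by the product of the two populations, and
AM-GM concludes. -/
theorem filterWeight_nonneg {N : ℕ} {b₀ b₁ : ℝ} (h₀ : 0 ≤ b₀) (h₁ : 0 ≤ b₁)
    (l : Fin N → Bloch) : 0 ≤ filterWeight b₀ b₁ l := by
  set A := ∏ i, (b₀ * (1 + (direction (l i)).fst)) with hA
  set B := ∏ i, (b₁ * (1 - (direction (l i)).fst)) with hB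
  set W := ∏ i, (((√(b₀ * b₁) : ℝ) : ℂ) * (direction (l i)).snd) with hW
  have hz := fun i => abs_le.mp (abs_fst_direction_le (l i))
  have hA0 : 0 ≤ A := Finset.prod_nonneg fun i _ => mul_nonneg h₀ (by linarith [(hz i).1])
  have hB0 : 0 ≤ B := Finset.prod_nonneg fun i _ => mul_nonneg h₁ (by linarith [(hz i).2])
  have hWAB : ‖W‖ ^ 2 ≤ A * B := by
    rw [hW, norm_prod, ← Finset.prod_pow, hA, hB, ← Finset.prod_mul_distrib]
    refine Finset.prod_le_prod (fun i _ => sq_nonneg _) fun i _ => ?_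
    have hsq : ‖direction (l i)‖ ^ 2 =
        (direction (l i)).fst ^ 2 + ‖(direction (l i)).snd‖ ^ 2 := by
      rw [WithLp.prod_norm_sq_eq_of_L2]; simp
    have hn2 : ‖direction (l i)‖ ^ 2 ≤ 1 := pow_le_one₀ (norm_nonneg _) (norm_direction_le _)
    rw [norm_mul, mul_pow, Complex.norm_real, Real.norm_eq_abs, sq_abs,
      Real.sq_sqrt (mul_nonneg h₀ h₁)]
    nlinarith [mul_nonneg h₀ h₁]
  have hre := (abs_le.mp (Complex.abs_re_le_norm W)).1
  have : 2 * ‖W‖ ≤ A + B := by nlinarith [sq_nonneg (A - B), norm_nonneg W]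
  change 0 ≤ A + B + 2 * W.re
  linarith

theorem measurable_filterWeight {N : ℕ} (b₀ b₁ : ℝ) :
    Measurable (filterWeight b₀ b₁ : (Fin N → Bloch) → ℝ) := by
  have h1 : ∀ i : Fin N, Measurable fun l : Fin N → Bloch => (direction (l i)).fst := fun i =>
    measurable_fst_direction.comp (measurable_pi_apply i)
  have h2 : ∀ i : Fin N, Measurable fun l : Fin N → Bloch => (direction (l i)).snd := fun i =>
    (show Measurable fun x : Bloch => x.snd by fun_prop).comp
      (measurable_direction.comp (measurable_pi_apply i))
  unfold filterWeight
  fun_prop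

/-- Each hidden-state entry is affine in `n`, so the integral needs only the mean and first moment
of the response. The equations `h₀`, `h₁` and `hx` equate the result with the two diagonal entries
and the coherence. -/
theorem assemblage_eq_integral {α θ a tx tz : ℝ} (h : UnsteerableParams a tx tz)
    (h₀ : (1 + α * Real.cos (2 * θ)) / 2 * (a + tz) = (α + Real.cos (2 * θ)) / 2)
    (h₁ : (1 - α * Real.cos (2 * θ)) / 2 * (a - tz) = (Real.cos (2 * θ) - α) / 2)
    (hx : √((1 + α * Real.cos (2 * θ)) / 2 * ((1 - α * Real.cos (2 * θ)) / 2)) * tx =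
      α * Real.sin (2 * θ) / 2)
    {P : Matrix (Fin 2) (Fin 2) ℂ} (hP : P.IsHermitian) (hi : P * P = P) (u v : Fin 2) :
    assemblage α θ P u v =
      ∫ x, (response a tx tz P x : ℂ) *
        hiddenState ((1 + α * Real.cos (2 * θ)) / 2) ((1 - α * Real.cos (2 * θ)) / 2)
          (direction x) u v ∂ballMeasure := by
  obtain ⟨p, hp⟩ : ∃ p : ℝ, P 0 0 = p :=
    ⟨(P 0 0).re, (Complex.conj_eq_iff_re.mp (hP.apply 0 0)).symm⟩
  obtain ⟨q, hq⟩ : ∃ q : ℝ, P 1 1 = q :=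
    ⟨(P 1 1).re, (Complex.conj_eq_iff_re.mp (hP.apply 1 1)).symm⟩
  have hw : P 0 1 = starRingEnd ℂ (P 1 0) := (hP.apply 0 1).symm
  have hR := integrable_response h hP hi
  have hRz : Integrable (fun x => response a tx tz P x * (direction x).fst) ballMeasure :=
    (integrable_response_smul_direction h hP hi).prodLp_fst
  have i0 := integral_response h hP hi
  have iz := integral_response_mul_fst h hP hi
  have iw := integral_response_mul_snd h hP hi
  rw [Matrix.trace, Fin.sum_univ_two, Matrix.diag_apply, Matrix.diag_apply] at i0
  simp only [hp, hq, Complex.sub_re, Complex.add_re, Complex.ofReal_re] at i0 iz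
  have iwc : ∫ x, (response a tx tz P x : ℂ) * starRingEnd ℂ (direction x).snd ∂ballMeasure =
      tx * P 0 1 := by
    rw [hw, ← Complex.conj_ofReal tx, ← map_mul, ← iw, ← integral_conj]
    simp only [map_mul, Complex.conj_ofReal]
  have hxc : ((√((1 + α * Real.cos (2 * θ)) / 2 * ((1 - α * Real.cos (2 * θ)) / 2)) : ℝ) : ℂ) *
      (tx : ℂ) = α * (Real.cos θ * Real.sin θ) := by
    rw [← Complex.ofReal_mul, hx, Real.sin_two_mul]
    push_cast
    ring
  have hdiag : ∀ b c : ℝ, ∫ x, (response a tx tz P x : ℂ) *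
      ((b * (1 + c * (direction x).fst) : ℝ) : ℂ) ∂ballMeasure =
      ((b * ((p + q + a * (p - q)) / 2 + c * (tz * (p - q) / 2)) : ℝ) : ℂ) := by
    intro b c
    rw [← i0, ← iz, ← integral_const_mul c, ← integral_add hR (hRz.const_mul c),
      ← integral_const_mul, ← integral_complex_ofReal]
    refine integral_congr_ae (Filter.Eventually.of_forall fun x => ?_)
    push_cast
    ring
  have hsc : Real.sin θ ^ 2 = 1 - Real.cos θ ^ 2 := Real.sin_sq θ
  fin_cases u <;> fin_cases v <;>
    simp only [hiddenState, Fin.zero_eta, Fin.mk_one, Matrix.cons_val_zero, Matrix.cons_val_one,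
      Matrix.cons_val_fin_one]
  · have e := hdiag ((1 + α * Real.cos (2 * θ)) / 2) 1
    simp only [one_mul] at e
    rw [e]
    have e1 : assemblage α θ P 0 0 =
        (((1 + α) / 2 * Real.cos θ ^ 2 * p + (1 - α) / 2 * Real.sin θ ^ 2 * q : ℝ) : ℂ) := by
      simp [assemblage, Fin.sum_univ_two, rhoTwo_apply, psi, hp, hq]
      ring_nf
      simp
    rw [e1]
    norm_cast
    rw [Real.cos_two_mul] at h₀ ⊢
    rw [hsc]
    linear_combination (-(p - q) / 2) * h₀
  · rw [show (fun x => (response a tx tz P x : ℂ) * (((√((1 + α * Real.cos (2 * θ)) / 2 *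
        ((1 - α * Real.cos (2 * θ)) / 2)) : ℝ) : ℂ) * (direction x).snd)) = fun x =>
        ((√((1 + α * Real.cos (2 * θ)) / 2 * ((1 - α * Real.cos (2 * θ)) / 2)) : ℝ) : ℂ) *
          ((response a tx tz P x : ℂ) * (direction x).snd) from funext fun x => by ring,
      integral_const_mul, iw, ← mul_assoc, hxc]
    simp [assemblage, Fin.sum_univ_two, rhoTwo_apply, psi]
  · rw [show (fun x => (response a tx tz P x : ℂ) * (((√((1 + α * Real.cos (2 * θ)) / 2 *
        ((1 - α * Real.cos (2 * θ)) / 2)) : ℝ) : ℂ) * starRingEnd ℂ (direction x).snd)) = fun x =>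
        ((√((1 + α * Real.cos (2 * θ)) / 2 * ((1 - α * Real.cos (2 * θ)) / 2)) : ℝ) : ℂ) *
          ((response a tx tz P x : ℂ) * starRingEnd ℂ (direction x).snd) from
        funext fun x => by ring,
      integral_const_mul, iwc, ← mul_assoc, hxc]
    simp only [assemblage, Fin.sum_univ_two, rhoTwo_apply]
    simp [psi, mul_comm (Complex.sin _)]
  · have e := hdiag ((1 - α * Real.cos (2 * θ)) / 2) (-1)
    simp only [neg_one_mul, ← sub_eq_add_neg] at e
    rw [e]
    have e1 : assemblage α θ P 1 1 =
        (((1 - α) / 2 * Real.cos θ ^ 2 * p + (1 + α) / 2 * Real.sin θ ^ 2 * q : ℝ) : ℂ) := by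
      simp [assemblage, Fin.sum_univ_two, rhoTwo_apply, psi, hp, hq]
      ring_nf
      simp
    rw [e1]
    norm_cast
    rw [Real.cos_two_mul] at h₁ ⊢
    rw [hsc]
    linear_combination (-(p - q) / 2) * h₁

theorem hasFullyLocalModel_rhoA {N : ℕ} (hN : 1 ≤ N) {α θ : ℝ} (hα0 : 0 < α) (hα1 : α ≤ 1)
    (hθ0 : 0 ≤ θ) (hθ1 : θ ≤ Real.pi / 4) (hb : steerBound α ≤ Real.cos (2 * θ) ^ 2) :
    HasFullyLocalModel (rhoA N α θ) := by
  have hC0 := cos_two_mul_nonneg hθ0 hθ1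
  have hC1 := Real.cos_le_one (2 * θ)
  have hS0 : 0 ≤ Real.sin (2 * θ) :=
    Real.sin_nonneg_of_nonneg_of_le_pi (by linarith) (by linarith [Real.pi_pos])
  obtain ⟨a, tx, tz, h, h₀, h₁, hx⟩ :=
    exists_unsteerableParams hα0 hα1 hC0 hS0 (Real.cos_sq_add_sin_sq _) hb
  have hass := fun {P : Matrix (Fin 2) (Fin 2) ℂ} (hP : P.IsHermitian) (hi : P * P = P) =>
    assemblage_eq_integral h h₀ h₁ hx hP hi
  set b₀ := (1 + α * Real.cos (2 * θ)) / 2 with hb₀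
  set b₁ := (1 - α * Real.cos (2 * θ)) / 2 with hb₁
  have hb₀0 : 0 ≤ b₀ := by positivity
  have hb₁0 : 0 ≤ b₁ := by
    have : α * Real.cos (2 * θ) ≤ 1 := mul_le_one₀ hα1 hC0 hC1
    rw [hb₁]; linarith
  have hZ := successProb_pos N hα0.le hα1 hθ0 hθ1
  set Z := successProb N α θ with hZdef
  set μ : Measure (Fin N → Bloch) := Measure.pi fun _ => ballMeasure with hμ
  have hτ : ∀ u v, Measurable fun x => hiddenState b₀ b₁ (direction x) u v := fun u v =>
    (measurable_hiddenState b₀ b₁ u v).comp measurable_direction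
  have key : ∀ P : Fin N → Matrix (Fin 2) (Fin 2) ℂ, (∀ i, (P i).IsHermitian) →
      (∀ i, P i * P i = P i) →
      Integrable (fun l : Fin N → Bloch => (((filterWeight b₀ b₁ l / Z) *
        ∏ i, response a tx tz (P i) (l i) : ℝ) : ℂ)) μ ∧
      (rhoA N α θ * localTensor P).trace =
        ((∫ l, (filterWeight b₀ b₁ l / Z) * ∏ i, response a tx tz (P i) (l i) ∂μ : ℝ) : ℂ) := by
    intro P hP hi
    have hint : ∀ u v i, Integrable (fun x => (response a tx tz (P i) x : ℂ) *
        hiddenState b₀ b₁ (direction x) u v) ballMeasure := fun u v i =>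
      (integrable_response h (hP i) (hi i)).ofReal.mul_bdd (hτ u v).aestronglyMeasurable
        (Filter.Eventually.of_forall fun x =>
          norm_hiddenState_le b₀ b₁ (norm_direction_le x) u v)
    have hprod : ∀ u v, Integrable (fun l : Fin N → Bloch => ∏ i,
        ((response a tx tz (P i) (l i) : ℂ) * hiddenState b₀ b₁ (direction (l i)) u v)) μ :=
      fun u v => Integrable.fintype_prod fun i => hint u v i
    have hpt : ∀ l : Fin N → Bloch, (((filterWeight b₀ b₁ l / Z) *
        ∏ i, response a tx tz (P i) (l i) : ℝ) : ℂ) = (Z : ℂ)⁻¹ * ∑ u, ∑ v, ∏ i,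
        ((response a tx tz (P i) (l i) : ℂ) * hiddenState b₀ b₁ (direction (l i)) u v) := by
      intro l
      simp only [Finset.prod_mul_distrib, ← Finset.mul_sum, sum_prod_hiddenState]
      push_cast
      ring
    refine ⟨?_, ?_⟩
    · simp only [hpt]
      exact (integrable_finsetSum _ fun u _ => integrable_finsetSum _ fun v _ =>
        hprod u v).const_mul _
    · rw [trace_rhoA_mul_localTensor hN, ← integral_complex_ofReal]
      simp only [hpt]
      rw [integral_const_mul, integral_finsetSum _ fun u _ => integrable_finsetSum _ fun v _ =>
        hprod u v]
      congr 1
      refine Finset.sum_congr rfl fun u _ => ?_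
      rw [integral_finsetSum _ fun v _ => hprod u v]
      refine Finset.sum_congr rfl fun v _ => ?_
      rw [hμ, integral_fintype_prod_eq_prod (fun i x => (response a tx tz (P i) x : ℂ) *
        hiddenState b₀ b₁ (direction x) u v)]
      exact Finset.prod_congr rfl fun i _ => hass (hP i) (hi i) u v
  have hWm : Measurable fun l : Fin N → Bloch => filterWeight b₀ b₁ l / Z :=
    (measurable_filterWeight b₀ b₁).div_const Z
  have hW0 : ∀ l : Fin N → Bloch, 0 ≤ filterWeight b₀ b₁ l / Z := fun l =>
    div_nonneg (filterWeight_nonneg hb₀0 hb₁0 l) hZ.le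
  have hlocal_one : localTensor (fun _ : Fin N => (1 : Matrix (Fin 2) (Fin 2) ℂ)) = 1 := by
    ext x y
    simp only [localTensor, Matrix.of_apply, Matrix.one_apply]
    by_cases hxy : x = y
    · simp [hxy]
    · obtain ⟨i, hi⟩ := Function.ne_iff.mp hxy
      rw [if_neg hxy]
      exact Finset.prod_eq_zero (Finset.mem_univ i) (if_neg hi)
  -- Trivial measurements always answer with probability 1, so this instance says that the
  -- reweighted density integrates to `tr ρ = 1`.
  obtain ⟨hWint, hWone⟩ := key (fun _ => 1) (fun _ => Matrix.isHermitian_one) (fun _ => mul_one 1)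
  simp only [response_one, Finset.prod_const_one, mul_one] at hWint hWone
  rw [hlocal_one, mul_one, (isDensity_rhoA hN hα0.le hα1 hθ0 hθ1).2] at hWone
  have hWone' : ∫ l, filterWeight b₀ b₁ l / Z ∂μ = 1 := by exact_mod_cast hWone.symm
  have hWint' : Integrable (fun l => filterWeight b₀ b₁ l / Z) μ := by
    simpa using hWint.re
  refine ⟨Fin N → Bloch, inferInstance,
    μ.withDensity fun l => ENNReal.ofReal (filterWeight b₀ b₁ l / Z), ⟨?_⟩,
    fun i k M c l => response a tx tz (M.P c) (l i), ?_, ?_, ?_, ?_⟩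
  · rw [withDensity_apply _ MeasurableSet.univ, Measure.restrict_univ,
      ← ofReal_integral_eq_lintegral_ofReal hWint' (Filter.Eventually.of_forall hW0), hWone',
      ENNReal.ofReal_one]
  · exact fun i k M c => (measurable_response _).comp (measurable_pi_apply i)
  · exact fun i k M c l => response_nonneg h (M.herm c) (M.idem c) _
  · exact fun i k M l => sum_response M _
  · intro k M c
    rw [(key (fun i => (M i).P (c i)) (fun i => (M i).herm _) (fun i => (M i).idem _)).2,
      integral_withDensity_eq_integral_toReal_smul hWm.ennreal_ofReal
        (Filter.Eventually.of_forall fun l => ENNReal.ofReal_lt_top)]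
    simp only [ENNReal.toReal_ofReal (hW0 _), smul_eq_mul]

end Model

/-! ### The choice `α = 1 - 1 / N²` -/

/-- Bernoulli's inequality gives `α^N ≥ 1 - 1/N` and `((1 + α)/2)^N ≥ 1 - 1/(2N)`. Their sum is at
least `2 - 3/(2N) ≥ 5/4`. -/
theorem one_lt_sum_pow {N : ℕ} (hN : 2 ≤ N) {α : ℝ} (hα : α = 1 - 1 / (N : ℝ) ^ 2) :
    1 < α ^ N + ((1 + α) / 2) ^ N + ((1 - α) / 2) ^ N := by
  have hN' : (2 : ℝ) ≤ N := by exact_mod_cast hN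
  have hNpos : (0 : ℝ) < N := by linarith
  have hsq : 1 / (N : ℝ) ^ 2 ≤ 1 := by
    rw [div_le_one (by positivity)]; nlinarith
  have hpos : 0 < 1 / (N : ℝ) ^ 2 := by positivity
  have hinv : 1 / (N : ℝ) ≤ 1 / 2 := one_div_le_one_div_of_le two_pos hN'
  have h1 := one_add_mul_le_pow (show (-2 : ℝ) ≤ -(1 / (N : ℝ) ^ 2) by linarith) N
  have h2 := one_add_mul_le_pow (show (-2 : ℝ) ≤ -(1 / (N : ℝ) ^ 2 / 2) by linarith) N
  have e1 : (N : ℝ) * -(1 / (N : ℝ) ^ 2) = -(1 / N) := by field_simp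
  have e2 : (N : ℝ) * -(1 / (N : ℝ) ^ 2 / 2) = -(1 / N) / 2 := by field_simp
  rw [e1, show 1 + -(1 / (N : ℝ) ^ 2) = α by rw [hα]; ring] at h1
  rw [e2, show 1 + -(1 / (N : ℝ) ^ 2 / 2) = (1 + α) / 2 by rw [hα]; ring] at h2
  have h3 : 0 ≤ ((1 - α) / 2) ^ N := pow_nonneg (by rw [hα]; linarith) N
  linarith

theorem steerBound_mem_Ico {α : ℝ} (h0 : 1 / 2 ≤ α) (h1 : α < 1) :
    0 ≤ steerBound α ∧ steerBound α < 1 := by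
  have hpos : 0 < (2 - α) * α ^ 3 := mul_pos (by linarith) (by positivity)
  refine ⟨div_nonneg (by linarith) hpos.le, ?_⟩
  rw [steerBound, div_lt_one hpos]
  -- The difference `(2 - α) α³ - (2α - 1)` factors as `(1 - α)³ (1 + α)`.
  have : 0 < (1 - α) ^ 3 * (1 + α) := mul_pos (pow_pos (by linarith) 3) (by linarith)
  nlinarith

theorem mainTheorem1 (N : ℕ) (hN : 2 ≤ N) :
    (∀ α θ : ℝ, 0 ≤ α → α ≤ 1 → 0 ≤ θ → θ ≤ Real.pi / 4 →
      IsDensity (rhoA N α θ) ∧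
      concurrence (rhoA N α θ) =
        2 * Real.sin (2 * θ) ^ N *
            (α ^ N + ((1 + α) / 2) ^ N + ((1 - α) / 2) ^ N - 1) /
          ((1 + α * Real.cos (2 * θ)) ^ N + (1 - α * Real.cos (2 * θ)) ^ N) ∧
      (0 < concurrence (rhoA N α θ) → IsGME (rhoA N α θ)) ∧
      (0 < α → steerBound α ≤ Real.cos (2 * θ) ^ 2 → HasFullyLocalModel (rhoA N α θ))) ∧
    (∀ α : ℝ, α = 1 - 1 / (N : ℝ) ^ 2 →
      1 < α ^ N + ((1 + α) / 2) ^ N + ((1 - α) / 2) ^ N ∧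
      (∃ θ : ℝ, 0 < θ ∧ θ ≤ Real.pi / 4 ∧ Real.cos (2 * θ) ^ 2 = steerBound α) ∧
      ∀ θ : ℝ, 0 < θ → θ ≤ Real.pi / 4 → Real.cos (2 * θ) ^ 2 = steerBound α →
        0 < concurrence (rhoA N α θ) ∧ IsGME (rhoA N α θ) ∧
          HasFullyLocalModel (rhoA N α θ)) := by
  have hN1 : 1 ≤ N := by omega
  refine ⟨fun α θ hα0 hα1 hθ0 hθ1 => ?_, fun α hα => ?_⟩
  · have hd := isDensity_rhoA hN1 hα0 hα1 hθ0 hθ1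
    exact ⟨hd, concurrence_rhoA hN1 hα0 hα1 hθ0 hθ1, isGME_of_concurrence_pos hN1 hd,
      fun hα0' hb => hasFullyLocalModel_rhoA hN1 hα0' hα1 hθ0 hθ1 hb⟩
  have hN' : (2 : ℝ) ≤ N := by exact_mod_cast hN
  have hpos : 0 < 1 / (N : ℝ) ^ 2 := by positivity
  have hquarter : 1 / (N : ℝ) ^ 2 ≤ 1 / 4 :=
    one_div_le_one_div_of_le (by norm_num) (by nlinarith)
  have hα0 : 1 / 2 ≤ α := by rw [hα]; linarith
  have hα1 : α < 1 := by rw [hα]; linarith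
  obtain ⟨hs0, hs1⟩ := steerBound_mem_Ico hα0 hα1
  have hgt := one_lt_sum_pow hN hα
  refine ⟨hgt, ?_, fun θ hθ0 hθ1 hcos => ?_⟩
  · have hr1 : √(steerBound α) < 1 := by
      rw [Real.sqrt_lt' one_pos]; simpa using hs1
    have hr0 := Real.sqrt_nonneg (steerBound α)
    refine ⟨Real.arccos √(steerBound α) / 2, half_pos (Real.arccos_pos.mpr hr1), ?_, ?_⟩
    · linarith [Real.arccos_le_pi_div_two.mpr hr0]
    · rw [mul_div_cancel₀ _ two_ne_zero, Real.cos_arccos (by linarith) hr1.le, Real.sq_sqrt hs0]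
  · have hα0' : 0 ≤ α := by linarith
    have hC : 0 < concurrence (rhoA N α θ) := by
      rw [concurrence_rhoA hN1 hα0' hα1.le hθ0.le hθ1]
      have hsin : 0 < Real.sin (2 * θ) :=
        Real.sin_pos_of_pos_of_lt_pi (by linarith) (by linarith [Real.pi_pos])
      have hc0 := cos_two_mul_nonneg hθ0.le hθ1
      have hc1 : α * Real.cos (2 * θ) ≤ 1 := mul_le_one₀ hα1.le hc0 (Real.cos_le_one _)
      have h1 : 0 ≤ (1 - α * Real.cos (2 * θ)) ^ N := pow_nonneg (by linarith) N
      have h2 : 0 < (1 + α * Real.cos (2 * θ)) ^ N := by positivity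
      exact div_pos (mul_pos (by positivity) (by linarith)) (by linarith)
    exact ⟨hC, isGME_of_concurrence_pos hN1 (isDensity_rhoA hN1 hα0' hα1.le hθ0.le hθ1) hC,
      hasFullyLocalModel_rhoA hN1 (by linarith) hα1.le hθ0.le hθ1 hcos.ge⟩
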